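/- Let $n\ge 3$, and let $g$ be a Riemannian metric of class $C^2$ on the sphere $S^n$ whose sectional curvatures are all positive. Let $R_{ij}$ denote its Ricci tensor, with the sign for which the round sphere has positive Ricci curvature. Then there is exactly one symmetric positive-definite twice-covariant tensor field $\chi$ on $S^n$ satisfying the once-contracted Gauss equation $$R_{ij} = (\operatorname{tr}\chi)\,\chi_{ij} - \chi_i{}^{k}\chi_{kj},$$ where the trace is taken, and the index raised, with respect to $g$ (that is, $\operatorname{tr}\chi=g^{ij}\chi_{ij}$ and $\chi_i{}^k=\chi_{il}g^{lk}$); uniqueness holds among all tensor fields, without any regularity assumption. Furthermore, if $g$ is of class $C^{k,\alpha}$ for some integer $k\ge 2$ and some $0\le\alpha<1$, then $\chi$ is of class $C^{k-2,\alpha}$. Here a tensor field is of class $C^{k,\alpha}$ if its components in each chart of the atlas of stereographic projections have continuous partial derivatives up to order $k$ and, when $\alpha>0$, those of order $k$ are locally Hölder continuous with exponent $\alpha$; in particular $C^{k,0}=C^k$. -/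

import Mathlib

open Metric Manifold Bundle Filter Topology Module
open scoped NNReal ContDiff

noncomputable section

namespace SphereGauss

/-- The coordinate space `ℝⁿ`. -/
abbrev Coord (n : ℕ) : Type := EuclideanSpace ℝ (Fin n)

/-- The unit sphere `Sⁿ ⊆ ℝⁿ⁺¹`, with Mathlib's manifold structure given by the atlas of
stereographic projections. -/
abbrev Sph (n : ℕ) : Type := sphere (0 : EuclideanSpace ℝ (Fin (n + 1))) 1

/-- The tangent space `T_p Sⁿ`. -/
abbrev Tan {n : ℕ} (p : Sph n) : Type := TangentSpace (𝓡 n) p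

/-- Twice-covariant tensor fields on `Sⁿ` (no regularity is imposed). -/
abbrev TensorField (n : ℕ) : Type := ∀ p : Sph n, Tan p →L[ℝ] Tan p →L[ℝ] ℝ

/-- Riemannian metrics on `Sⁿ` with two continuous derivatives. -/
abbrev C2Metric (n : ℕ) : Type :=
  ContMDiffRiemannianMetric (𝓡 n) 2 (Coord n) (fun p : Sph n => TangentSpace (𝓡 n) p)

/-! ### Curvature in local coordinates

In this section `G y` is the metric (a bilinear form on `ℝⁿ`) at the coordinate point `y`. -/

section Local

variable {n : ℕ}

/-- The Christoffel symbols of the first kind, as the covector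
`w ↦ ½ (∂_u G (v, w) + ∂_v G (u, w) - ∂_w G (u, v))`. -/
def christoffelLower (G : Coord n → Coord n →L[ℝ] Coord n →L[ℝ] ℝ) (y u v : Coord n) :
    Coord n →L[ℝ] ℝ :=
  (1 / 2 : ℝ) •
    (fderiv ℝ G y u v + fderiv ℝ G y v u - ((fderiv ℝ G y).flip u).flip v)

/-- The Christoffel symbols `Γ(u, v)`, with components `Γᵏᵢⱼ uⁱ vʲ`: the index of
`christoffelLower` is raised with the inverse of the metric. -/
def christoffel (G : Coord n → Coord n →L[ℝ] Coord n →L[ℝ] ℝ) (y u v : Coord n) : Coord n :=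
  (G y).inverse (christoffelLower G y u v)

/-- The Riemann curvature
`R(u, v) w = ∂_u Γ (v, w) - ∂_v Γ (u, w) + Γ(u, Γ(v, w)) - Γ(v, Γ(u, w))`, that is
`∇_u ∇_v w - ∇_v ∇_u w` for fields `u, v, w` with constant coefficients. -/
def riemann (G : Coord n → Coord n →L[ℝ] Coord n →L[ℝ] ℝ) (y u v w : Coord n) : Coord n :=
  fderiv ℝ (fun z => christoffel G z v w) y u - fderiv ℝ (fun z => christoffel G z u w) y v
    + christoffel G y u (christoffel G y v w) - christoffel G y v (christoffel G y u w)

/-- The Ricci curvature `Ric(v, w)`, the trace of `u ↦ R(u, v) w`. -/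
def ricciLocal (G : Coord n → Coord n →L[ℝ] Coord n →L[ℝ] ℝ) (y v w : Coord n) : ℝ :=
  ∑ i : Fin n, (riemann G y (EuclideanSpace.single i 1) v w) i

end Local

/-! ### Tensor fields on the sphere -/

section Global

variable {n : ℕ}

/-- The coordinate expression of the tensor field `T` in the chart around `p₀`: the pull-back of
`T` under the inverse of the chart, with components
`T_ij(y) = T (∂_i, ∂_j)` where `∂_i = d(chart⁻¹)_y e_i`. -/
def inChart (T : TensorField n) (p₀ : Sph n) (y : Coord n) : Coord n →L[ℝ] Coord n →L[ℝ] ℝ :=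
  let φ : Coord n → Sph n := (extChartAt (𝓡 n) p₀).symm
  let A : Coord n →L[ℝ] Coord n := mfderiv 𝓘(ℝ, Coord n) (𝓡 n) φ y
  let B : Coord n →L[ℝ] Coord n →L[ℝ] ℝ := T (φ y)
  B.bilinearComp A A

/-- At `p` itself the chart around `p` induces the identification of `T_p Sⁿ` with `ℝⁿ` that is
built into `TangentSpace`: there the coordinate expression of `T` is `T p`. -/
theorem inChart_self (T : TensorField n) (p : Sph n) (u v : Coord n) :
    inChart T p (extChartAt (𝓡 n) p p) u v = T p u v := by
  have h := mfderivWithin_range_extChartAt_symm (I := 𝓡 n) (x := p)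
  simp only [modelWithCornersSelf_coe, Set.range_id, mfderivWithin_univ] at h
  have key : ∀ (q : Sph n) (A : Coord n →L[ℝ] Coord n), q = p →
      A = ContinuousLinearMap.id ℝ (Coord n) →
      ((T q : Coord n →L[ℝ] Coord n →L[ℝ] ℝ).bilinearComp A A) u v = T p u v := by
    rintro q A rfl rfl
    rfl
  exact key _ _ (extChartAt_to_inv p) h

/-- `T` is of class `C^{k,α}`: in each chart the components of `T` have continuous derivatives up
to order `k`, and those of order `k` are locally Hölder continuous with exponent `α`.
For `α = 0` the last condition only says that they are locally bounded, so `C^{k,0} = C^k`. -/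
def IsHolderClass (k : ℕ) (α : ℝ≥0) (T : TensorField n) : Prop :=
  ∀ p₀ : Sph n,
    ContDiffOn ℝ k (inChart T p₀) (extChartAt (𝓡 n) p₀).target ∧
    ∀ y ∈ (extChartAt (𝓡 n) p₀).target, ∃ U ∈ 𝓝 y, ∃ C : ℝ≥0,
      HolderOnWith C α (iteratedFDeriv ℝ k (inChart T p₀)) U

/-- The Riemann curvature `R(u, v) w` of `g` at `p`. A tangent vector at `p` is, in Mathlib, the
vector of its coordinates in the preferred chart around `p`; accordingly the curvature is
evaluated in that chart. -/
def riemannAt (g : C2Metric n) (p : Sph n) (u v w : Tan p) : Tan p :=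
  riemann (inChart g.inner p) (extChartAt (𝓡 n) p p) u v w

/-- The sectional curvature of the plane spanned by `u` and `v`. -/
def sectionalCurvature (g : C2Metric n) (p : Sph n) (u v : Tan p) : ℝ :=
  g.inner p (riemannAt g p u v v) u /
    (g.inner p u u * g.inner p v v - g.inner p u v ^ 2)

/-- All sectional curvatures are positive. -/
def HasPositiveSectionalCurvature (g : C2Metric n) : Prop :=
  ∀ (p : Sph n) (u v : Tan p), LinearIndependent ℝ ![u, v] → 0 < sectionalCurvature g p u v

/-- The Ricci curvature of `g` at `p`, the trace of `u ↦ R(u, v) w`, evaluated in the preferred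
chart around `p`. -/
def ricci (g : C2Metric n) (p : Sph n) (v w : Tan p) : ℝ :=
  ricciLocal (inChart g.inner p) (extChartAt (𝓡 n) p p) v w

/-- The endomorphism `χ_i^k` of `T_p Sⁿ` obtained by raising an index of `χ` with the metric:
`g (shape u, v) = χ (u, v)`. -/
def shape (g : C2Metric n) (χ : TensorField n) (p : Sph n) : Tan p →L[ℝ] Tan p :=
  (g.inner p).inverse ∘L χ p

/-- The trace `tr χ = g^{ij} χ_ij` with respect to `g`. -/
def metricTrace (g : C2Metric n) (χ : TensorField n) (p : Sph n) : ℝ :=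
  LinearMap.trace ℝ (Tan p) (shape g χ p : Tan p →ₗ[ℝ] Tan p)

/-- `χ` is symmetric. -/
def IsSymm (χ : TensorField n) : Prop :=
  ∀ (p : Sph n) (u v : Tan p), χ p u v = χ p v u

/-- `χ` is positive definite. -/
def IsPosDef (χ : TensorField n) : Prop :=
  ∀ (p : Sph n) (u : Tan p), u ≠ 0 → 0 < χ p u u

/-- The once-contracted Gauss equation `R_ij = (tr χ) χ_ij - χ_i^k χ_kj`. -/
def OnceContractedGauss (g : C2Metric n) (χ : TensorField n) : Prop :=
  ∀ (p : Sph n) (u v : Tan p),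
    ricci g p u v = metricTrace g χ p * χ p u v - χ p (shape g χ p u) v

/-- `χ` is a symmetric positive-definite solution of the once-contracted Gauss equation. -/
def IsSolution (g : C2Metric n) (χ : TensorField n) : Prop :=
  IsSymm χ ∧ IsPosDef χ ∧ OnceContractedGauss g χ

end Global

end SphereGauss

end

/-! At each point the equation is algebraic: with A = g⁻¹χ it says that (tr A)A − A² is the Ricci
endomorphism. Existence and uniqueness are therefore linear algebra on a single tangent space, and
only regularity links different points.

Existence. In a g-orthonormal eigenbasis of Ric with eigenvalues rᵢ, a diagonal χ with entries lᵢ is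
a solution when lᵢ(∑ l − lᵢ) = rᵢ. Since rᵢ is the sum of the sectional curvatures Kᵢⱼ over j ≠ i,
positivity of the Kᵢⱼ and n ≥ 3 give rᵢ > 0 and 2rᵢ < ∑ r. Under these two conditions
`exists_scalar_solution` finds positive lᵢ by the intermediate value theorem, with H = ∑ l as the
unknown.

Uniqueness. The map Q(χ) = (tr A)χ − χA is quadratic, so 2(Q(X) − Q(Y)) is its linearization at X +
Y applied to X − Y (`gaussMap_sub`). The linearization at a positive-definite form is injective when
n ≥ 3 (`eq_zero_of_gaussLin_eq_zero`), and X + Y is positive definite.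

Regularity. The same injectivity feeds the implicit function theorem: locally χ = Θ(g, Ric) with Θ
as often differentiable as desired. Uniqueness needs no continuity, so an arbitrary solution
coincides with this one. The class C^{k,α} is stable under composition with C^{k+1} maps, and Ric
costs two derivatives of g. Because Ricci at p is defined in the chart around p, its invariance
under coordinate changes (`IsPullbackAt.ricciLocal`) is needed to work in one fixed chart. -/

noncomputable section

set_option maxSynthPendingDepth 3

namespace SphereGauss

/-! ### The scalar equations `λᵢ (∑ⱼ λⱼ - λᵢ) = ρᵢ` -/

section Scalar

variable {n : ℕ}

theorem exists_notMem_pair (hn : 3 ≤ n) (i j : Fin n) :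
    ∃ k, k ∉ ({i, j} : Finset (Fin n)) := by
  by_contra! h
  have h1 : Fintype.card (Fin n) ≤ ({i, j} : Finset (Fin n)).card :=
    Finset.card_le_card (fun x _ => h x)
  have h2 := Finset.card_le_two (a := i) (b := j)
  simp only [Fintype.card_fin] at h1
  omega

/-- Uniqueness rests on this strictness. In dimension two there is equality; there (tr A)A − A² =
(det A)·1, so χ is far from determined. -/
theorem add_lt_sum_of_pos (hn : 3 ≤ n) {l : Fin n → ℝ} (hl : ∀ i, 0 < l i) {i j : Fin n}
    (hij : i ≠ j) : l i + l j < ∑ k, l k := by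
  obtain ⟨k, hk⟩ := exists_notMem_pair hn i j
  rw [← Finset.sum_pair hij]
  exact Finset.sum_lt_sum_of_subset (Finset.subset_univ _) (Finset.mem_univ k) hk (hl k)
    (fun a _ _ => (hl a).le)

/-- With H = ∑ l and b = ∑ x the equations read (2lᵢ − H)xᵢ = b lᵢ. If b = 0, a nonzero xᵢ forces
2lᵢ = H, which at most one index can satisfy, so b = xᵢ ≠ 0. If b ≠ 0, dividing and summing gives ∑
lᵢ/(2lᵢ − H) = 1; this is impossible if all denominators are negative, and otherwise the sum exceeds
1. -/
theorem eq_zero_of_linearized_scalar (hn : 3 ≤ n) {l x : Fin n → ℝ} (hl : ∀ i, 0 < l i)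
    (h : ∀ i, (∑ k, x k) * l i + (∑ k, l k) * x i - l i * x i - x i * l i = 0) (i : Fin n) :
    x i = 0 := by
  set H := ∑ k, l k with hH
  set b := ∑ k, x k with hb
  have hx : ∀ i, b * l i = (2 * l i - H) * x i := fun i => by linarith [h i]
  by_cases hb0 : b = 0
  · by_contra hi
    have hli : 2 * l i - H = 0 := by
      have := hx i
      rw [hb0, zero_mul] at this
      exact (mul_eq_zero.1 this.symm).resolve_right hi
    have hj : ∀ j, j ≠ i → x j = 0 := fun j hj => by
      have := hx j
      rw [hb0, zero_mul] at this
      refine (mul_eq_zero.1 this.symm).resolve_left ?_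
      have := add_lt_sum_of_pos hn hl hj
      intro h2
      linarith
    have : b = x i := Finset.sum_eq_single i (fun j _ => hj j) (by simp)
    exact hi (this ▸ hb0)
  exfalso
  have hne : ∀ i, 2 * l i - H ≠ 0 := fun i h0 => by
    have := hx i
    rw [h0, zero_mul] at this
    exact (mul_ne_zero hb0 (hl i).ne') this
  have hsum : ∑ k, l k / (2 * l k - H) = 1 := by
    have h1 : ∀ k, x k = b * (l k / (2 * l k - H)) := fun k => by
      rw [← mul_div_assoc, hx k, mul_div_cancel_left₀ _ (hne k)]
    have h2 : b = b * ∑ k, l k / (2 * l k - H) := by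
      rw [Finset.mul_sum, hb]
      exact Finset.sum_congr rfl fun k _ => h1 k
    exact (mul_right_injective₀ hb0 (by simpa using h2)).symm
  by_cases hall : ∀ k, 2 * l k - H < 0
  · have : ∑ k, l k / (2 * l k - H) ≤ 0 :=
      Finset.sum_nonpos fun k _ => (div_neg_of_pos_of_neg (hl k) (hall k)).le
    linarith
  push Not at hall
  obtain ⟨m, hm⟩ := hall
  have hm : 0 < 2 * l m - H := lt_of_le_of_ne hm (hne m).symm
  have hHm : H = l m + ∑ k ∈ Finset.univ.erase m, l k :=
    (Finset.add_sum_erase _ _ (Finset.mem_univ m)).symm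
  have h1 : 1 = l m / (2 * l m - H) + ∑ k ∈ Finset.univ.erase m, l k / (2 * l k - H) := by
    rw [← hsum]
    exact (Finset.add_sum_erase _ _ (Finset.mem_univ m)).symm
  set s := ∑ k ∈ Finset.univ.erase m, l k with hs
  -- From lₖ + lₘ < H follows H − 2lₖ > 2lₘ − H > 0, so each negative term has smaller modulus than
  -- with denominator 2lₘ − H. With the common denominator the whole sum would be (lₘ − (H −
  -- lₘ))/(2lₘ − H) = 1.
  have h2 : ∑ k ∈ Finset.univ.erase m, -(l k / (2 * l m - H)) <
      ∑ k ∈ Finset.univ.erase m, l k / (2 * l k - H) := by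
    refine Finset.sum_lt_sum_of_nonempty ?_ fun k hk => ?_
    · rw [← Finset.card_pos, Finset.card_erase_of_mem (Finset.mem_univ m)]
      simp only [Finset.card_univ, Fintype.card_fin]
      omega
    · have hk : k ≠ m := (Finset.mem_erase.1 hk).1
      have h3 := add_lt_sum_of_pos hn hl hk
      have h4 : l k / (2 * l k - H) = -(l k / (H - 2 * l k)) := by
        rw [← div_neg, neg_sub]
      rw [h4, neg_lt_neg_iff]
      exact div_lt_div_of_pos_left (hl k) hm (by linarith)
  rw [Finset.sum_neg_distrib, ← Finset.sum_div] at h2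
  have h5 : l m / (2 * l m - H) - s / (2 * l m - H) = 1 := by
    rw [← sub_div, div_eq_one_iff_eq hm.ne']
    linarith
  linarith

/-- The smaller root `x` of `x (H - x) = r`. -/
def smallRoot (H r : ℝ) : ℝ := (H - √(H ^ 2 - 4 * r)) / 2

theorem continuous_smallRoot (r : ℝ) : Continuous fun H => smallRoot H r := by
  unfold smallRoot
  fun_prop

theorem smallRoot_eq {H r : ℝ} (h : 4 * r ≤ H ^ 2) :
    H * smallRoot H r - smallRoot H r ^ 2 = r := by
  have := Real.sq_sqrt (sub_nonneg.2 h)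
  unfold smallRoot
  linear_combination (-1 / 4 : ℝ) * this

theorem smallRoot_pos {H r : ℝ} (hH : 0 < H) (hr : 0 < r) : 0 < smallRoot H r := by
  have : √(H ^ 2 - 4 * r) < H := by
    rw [Real.sqrt_lt' hH]
    linarith
  unfold smallRoot
  linarith

theorem smallRoot_le_half (H r : ℝ) : smallRoot H r ≤ H / 2 := by
  have := Real.sqrt_nonneg (H ^ 2 - 4 * r)
  unfold smallRoot
  linarith

theorem div_le_smallRoot {H r : ℝ} (hH : 0 < H) (h : 4 * r ≤ H ^ 2) :
    r / H ≤ smallRoot H r := by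
  have h1 : √(H ^ 2 - 4 * r) ≤ H - 2 * (r / H) := by
    rw [Real.sqrt_le_iff]
    have hr : r / H * H = r := div_mul_cancel₀ _ hH.ne'
    constructor
    · by_contra! h0
      nlinarith
    · nlinarith [sq_nonneg (r / H)]
  unfold smallRoot
  linarith

/-- The hypothesis says that x(H − x) ≥ r at x = s/H, so s/H lies between the two roots. -/
theorem smallRoot_le_div {H r s : ℝ} (hH : 0 < H) (h : (s / H) ^ 2 ≤ s - r) :
    smallRoot H r ≤ s / H := by
  have h1 : H - 2 * (s / H) ≤ √(H ^ 2 - 4 * r) := by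
    refine (le_abs_self _).trans (Real.abs_le_sqrt ?_)
    have hr : s / H * H = s := div_mul_cancel₀ _ hH.ne'
    nlinarith
  unfold smallRoot
  linarith

theorem div_sq_le {H s d : ℝ} (hd : 0 < d) (h1 : 1 ≤ H) (h : s ^ 2 / d ≤ H) :
    (s / H) ^ 2 ≤ d := by
  rw [div_pow, div_le_iff₀ (by positivity)]
  rw [div_le_iff₀ hd] at h
  nlinarith [mul_le_mul_of_nonneg_right h1 (by nlinarith : 0 ≤ H * d)]

/-- Each lᵢ is a root of x(H − x) = rᵢ with H = ∑ l. As lᵢ + lⱼ < H for i ≠ j, at most one lᵢ can be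
the larger root, and it must belong to the largest r. This leaves two branches, each a single
continuous equation for H. -/
theorem exists_scalar_solution (hn : 3 ≤ n) {r : Fin n → ℝ} (hr : ∀ i, 0 < r i)
    (h : ∀ i, 2 * r i < ∑ k, r k) :
    ∃ l : Fin n → ℝ, (∀ i, 0 < l i) ∧ ∀ i, (∑ k, l k) * l i - l i ^ 2 = r i := by
  have : Nonempty (Fin n) := ⟨⟨0, by omega⟩⟩
  obtain ⟨m, hm⟩ := Finite.exists_max r
  set H₀ := 2 * √(r m) with hH₀
  have hH₀pos : 0 < H₀ := mul_pos two_pos (Real.sqrt_pos.2 (hr m))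
  have hH₀sq : H₀ ^ 2 = 4 * r m := by
    rw [hH₀, mul_pow, Real.sq_sqrt (hr m).le]
    norm_num
  have hdisc : ∀ H, H₀ ≤ H → ∀ i, 4 * r i ≤ H ^ 2 := fun H hH i => by
    have := hm i
    nlinarith
  have hcont : Continuous fun H => ∑ k, smallRoot H (r k) :=
    continuous_finsetSum _ fun k _ => continuous_smallRoot (r k)
  -- H₀ is the least H with real roots for every index; there the two roots for m coincide, so the
  -- two branches meet. The sign of ∑ `smallRoot` − H at H₀ decides which branch has a zero beyond
  -- H₀: all smaller roots, or the larger root at m.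
  by_cases hf : H₀ ≤ ∑ k, smallRoot H₀ (r k)
  · set S := ∑ k, r k with hS
    have hSpos : 0 < S := Finset.sum_pos (fun k _ => hr k) Finset.univ_nonempty
    -- The summands 4rₖ = (2rₖ)²/(2rₖ − rₖ) make each small root at most 2rₖ/H₁, and 1 + 2S gives 2S
    -- ≤ H₁².
    set H₁ := H₀ + 1 + 2 * S + ∑ k, 4 * r k with hH₁
    have h4 : 0 < ∑ k, 4 * r k := Finset.sum_pos (fun k _ => by linarith [hr k])
      Finset.univ_nonempty
    have hup : ∑ k, smallRoot H₁ (r k) ≤ H₁ := by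
      have h1 : ∀ k, smallRoot H₁ (r k) ≤ 2 * r k / H₁ := fun k => by
        refine smallRoot_le_div (by linarith) (div_sq_le ?_ (by linarith) ?_)
        · linarith [hr k]
        · have : (2 * r k) ^ 2 / (2 * r k - r k) = 4 * r k := by
            have := (hr k).ne'
            field_simp
            ring
          rw [this]
          have := Finset.single_le_sum (f := fun k => 4 * r k)
            (fun k _ => by linarith [hr k]) (Finset.mem_univ k)
          linarith
      refine (Finset.sum_le_sum fun k _ => h1 k).trans ?_
      rw [← Finset.sum_div, ← Finset.mul_sum, div_le_iff₀ (by linarith)]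
      nlinarith
    obtain ⟨H, hH, hz⟩ : ∃ H ∈ Set.Icc H₀ H₁, (∑ k, smallRoot H (r k)) - H = 0 := by
      have := intermediate_value_Icc' (by linarith : H₀ ≤ H₁)
        (hcont.sub continuous_id).continuousOn
      exact this ⟨sub_nonpos.2 hup, sub_nonneg.2 hf⟩
    have hHs : ∑ k, smallRoot H (r k) = H := by linarith
    refine ⟨fun i => smallRoot H (r i), fun i => smallRoot_pos (by linarith [hH.1]) (hr i),
      fun i => ?_⟩
    rw [hHs]
    exact smallRoot_eq (hdisc H hH.1 i)
  · push Not at hf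
    have hsplit : ∀ f : Fin n → ℝ, ∑ k, f k = f m + ∑ k ∈ Finset.univ.erase m, f k := fun f =>
      (Finset.add_sum_erase _ _ (Finset.mem_univ m)).symm
    set S := ∑ k ∈ Finset.univ.erase m, r k with hS
    have hSr : r m < S := by
      have := h m
      rw [hsplit r] at this
      linarith
    -- For large H the small roots behave like rₖ/H, so F is eventually positive because rₘ < S.
    -- This H₁ is large enough for S/H₁ to separate the root at m from the sum of the others.
    set H₁ := H₀ + 1 + S ^ 2 / (S - r m) with hH₁
    have h0 : 0 ≤ S ^ 2 / (S - r m) := div_nonneg (sq_nonneg _) (by linarith)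
    set F : ℝ → ℝ := fun H => (∑ k, smallRoot H (r k)) - 2 * smallRoot H (r m) with hF
    have hFc : Continuous F := hcont.sub (continuous_const.mul (continuous_smallRoot _))
    have hlow : F H₀ ≤ 0 := by
      have : smallRoot H₀ (r m) = H₀ / 2 := by
        simp [smallRoot, hH₀sq]
      simp only [hF, this]
      linarith
    have hup : 0 ≤ F H₁ := by
      have hpos : 0 < H₁ := by linarith
      have h1 : smallRoot H₁ (r m) ≤ S / H₁ :=
        smallRoot_le_div hpos (div_sq_le (by linarith) (by linarith) (by linarith))
      have h2 : S / H₁ ≤ ∑ k ∈ Finset.univ.erase m, smallRoot H₁ (r k) := by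
        rw [hS, Finset.sum_div]
        exact Finset.sum_le_sum fun k _ => div_le_smallRoot hpos (hdisc H₁ (by linarith) k)
      simp only [hF, hsplit fun k => smallRoot H₁ (r k)]
      linarith
    obtain ⟨H, hH, hz⟩ : ∃ H ∈ Set.Icc H₀ H₁, F H = 0 :=
      intermediate_value_Icc (by linarith : H₀ ≤ H₁) hFc.continuousOn ⟨hlow, hup⟩
    have hpos : 0 < H := by linarith [hH.1]
    set l : Fin n → ℝ := Function.update (fun i => smallRoot H (r i)) m
      (H - smallRoot H (r m)) with hl
    have hlm : l m = H - smallRoot H (r m) := by simp [hl]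
    have hli : ∀ i, i ≠ m → l i = smallRoot H (r i) := fun i hi => by simp [hl, hi]
    have hsum : ∑ k, l k = H := by
      have h1 : ∑ k ∈ Finset.univ.erase m, l k = ∑ k ∈ Finset.univ.erase m, smallRoot H (r k) :=
        Finset.sum_congr rfl fun k hk => hli k (Finset.ne_of_mem_erase hk)
      simp only [hF, hsplit fun k => smallRoot H (r k)] at hz
      rw [hsplit l, hlm, h1]
      linarith
    refine ⟨l, fun i => ?_, fun i => ?_⟩
    · by_cases hi : i = m
      · rw [hi, hlm]
        linarith [smallRoot_le_half H (r m)]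
      · rw [hli i hi]
        exact smallRoot_pos hpos (hr i)
    · rw [hsum]
      by_cases hi : i = m
      · rw [hi, hlm]
        linear_combination smallRoot_eq (hdisc H hH.1 m)
      · rw [hli i hi]
        exact smallRoot_eq (hdisc H hH.1 i)

end Scalar

section Algebra

/-! ### Simultaneous diagonalization and the algebraic Gauss equation -/

/-- The spectral theorem for the endomorphism G⁻¹M, which is self-adjoint for the inner product G.
-/
theorem exists_basis_diagonal {V : Type*} [AddCommGroup V] [Module ℝ V] [FiniteDimensional ℝ V]
    {n : ℕ} (hn : finrank ℝ V = n) (G M : V →ₗ[ℝ] V →ₗ[ℝ] ℝ) (hG : ∀ u v, G u v = G v u)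
    (hpos : ∀ u, u ≠ 0 → 0 < G u u) (hM : ∀ u v, M u v = M v u) :
    ∃ (b : Basis (Fin n) ℝ V) (l : Fin n → ℝ),
      (∀ i j, G (b i) (b j) = if i = j then 1 else 0) ∧ ∀ i v, M (b i) v = l i * G (b i) v := by
  let core : InnerProductSpace.Core ℝ V :=
    { inner := fun u v => G u v
      conj_inner_symm := fun u v => by simpa using hG v u
      re_inner_nonneg := fun u => by
        by_cases hu : u = 0
        · simp [hu]
        · simpa using (hpos u hu).le
      add_left := fun u v w => by simp
      smul_left := fun u v r => by simp
      definite := fun u hu => by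
        by_contra h
        exact (hpos u h).ne' hu }
  let _ : NormedAddCommGroup V := core.toNormedAddCommGroup
  let _ : InnerProductSpace ℝ V := InnerProductSpace.ofCore core.toCore
  have hinner : ∀ u v : V, inner ℝ u v = G u v := fun _ _ => rfl
  have hinj : Function.Injective G := by
    rw [← LinearMap.ker_eq_bot, LinearMap.ker_eq_bot']
    intro u hu
    by_contra h
    exact (hpos u h).ne' (by simp [hu])
  let e : V ≃ₗ[ℝ] (V →ₗ[ℝ] ℝ) :=
    LinearEquiv.ofInjectiveOfFinrankEq G hinj (Subspace.dual_finrank_eq (K := ℝ) (V := V)).symm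
  let T : V →ₗ[ℝ] V := e.symm.toLinearMap ∘ₗ M
  have hT : ∀ u v, G (T u) v = M u v := fun u v => by
    have : e (T u) = M u := e.apply_symm_apply _
    exact congrArg (fun f : V →ₗ[ℝ] ℝ => f v) this
  have hsym : T.IsSymmetric := fun u v => by
    rw [hinner, hinner, hT, hG, hT, hM]
  let b := hsym.eigenvectorBasis hn
  refine ⟨b.toBasis, hsym.eigenvalues hn, fun i j => ?_, fun i v => ?_⟩
  · have := orthonormal_iff_ite.1 b.orthonormal i j
    simpa [hinner] using this
  · have h := hsym.apply_eigenvectorBasis hn i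
    rw [← hT]
    change G (T (b.toBasis i)) v = _
    rw [b.coe_toBasis]
    simp only [b, h]
    simp

/-! ### The quadratic Gauss map and its linearization -/

variable {E : Type*} [NormedAddCommGroup E] [NormedSpace ℝ E]

/-- A symmetric positive-definite bilinear form. -/
structure IsInner (G : E →L[ℝ] E →L[ℝ] ℝ) : Prop where
  symm : ∀ u v, G u v = G v u
  pos : ∀ u, u ≠ 0 → 0 < G u u

/-- The right-hand side `(tr χ) χ_ij - χ_i^k χ_kj` of the contracted Gauss equation. -/
def gaussMap (G X : E →L[ℝ] E →L[ℝ] ℝ) : E →L[ℝ] E →L[ℝ] ℝ :=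
  LinearMap.trace ℝ E (G.inverse ∘L X : E →L[ℝ] E) • X - X ∘L G.inverse ∘L X

/-- The derivative of `gaussMap G` at `M` in direction `X`. -/
def gaussLin (G M X : E →L[ℝ] E →L[ℝ] ℝ) : E →L[ℝ] E →L[ℝ] ℝ :=
  LinearMap.trace ℝ E (G.inverse ∘L X : E →L[ℝ] E) • M +
    LinearMap.trace ℝ E (G.inverse ∘L M : E →L[ℝ] E) • X -
    M ∘L G.inverse ∘L X - X ∘L G.inverse ∘L M

/-- Polarization of a quadratic map: it turns injectivity of the linearization into uniqueness for
the nonlinear equation. -/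
theorem gaussMap_sub (G X Y : E →L[ℝ] E →L[ℝ] ℝ) :
    gaussLin G (X + Y) (X - Y) = (2 : ℝ) • (gaussMap G X - gaussMap G Y) := by
  simp only [gaussLin, gaussMap, ContinuousLinearMap.comp_add, ContinuousLinearMap.comp_sub,
    ContinuousLinearMap.toLinearMap_add, ContinuousLinearMap.toLinearMap_sub, map_add, map_sub,
    ContinuousLinearMap.add_comp, ContinuousLinearMap.sub_comp]
  ext u v
  simp only [sub_apply, add_apply, smul_apply, smul_eq_mul]
  ring

theorem bilin_ext {n : ℕ} {X Y : E →L[ℝ] E →L[ℝ] ℝ} (b : Basis (Fin n) ℝ E)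
    (h : ∀ i j, X (b i) (b j) = Y (b i) (b j)) : X = Y := by
  have h1 : ∀ i, X (b i) = Y (b i) := fun i =>
    ContinuousLinearMap.coe_injective (b.ext (h i))
  exact ContinuousLinearMap.coe_injective (b.ext h1)

theorem repr_of_orthonormal {n : ℕ} {b : Basis (Fin n) ℝ E} {G : E →L[ℝ] E →L[ℝ] ℝ}
    (hb : ∀ i j, G (b i) (b j) = if i = j then 1 else 0) (v : E)
    (i : Fin n) : b.repr v i = G v (b i) := by
  have h := congrArg (fun w => G w (b i)) (b.sum_repr v)
  simp only [map_sum, map_smul, sum_apply, smul_apply, hb, smul_eq_mul, mul_ite, mul_one,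
    mul_zero, Finset.sum_ite_eq', Finset.mem_univ, if_true] at h
  exact h

theorem trace_of_orthonormal {n : ℕ} {b : Basis (Fin n) ℝ E} {G : E →L[ℝ] E →L[ℝ] ℝ}
    (hb : ∀ i j, G (b i) (b j) = if i = j then 1 else 0)
    (T : E →ₗ[ℝ] E) : LinearMap.trace ℝ E T = ∑ i, G (T (b i)) (b i) := by
  rw [LinearMap.trace_eq_matrix_trace ℝ b, Matrix.trace]
  exact Finset.sum_congr rfl fun i _ => by
    rw [Matrix.diag_apply, LinearMap.toMatrix_apply, repr_of_orthonormal hb]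

variable [FiniteDimensional ℝ E]

theorem IsInner.isInvertible {G : E →L[ℝ] E →L[ℝ] ℝ} (hG : IsInner G) : G.IsInvertible := by
  have hinj : Function.Injective (G : E →ₗ[ℝ] E →L[ℝ] ℝ) := by
    rw [← LinearMap.ker_eq_bot, LinearMap.ker_eq_bot']
    intro u hu
    by_contra h
    have hu : G u = 0 := hu
    exact (hG.pos u h).ne' (by simp [hu])
  have hdim : finrank ℝ E = finrank ℝ (E →L[ℝ] ℝ) := by
    rw [← (LinearMap.toContinuousLinearMap (𝕜 := ℝ) (E := E) (F' := ℝ)).finrank_eq]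
    exact (Subspace.dual_finrank_eq (K := ℝ) (V := E)).symm
  refine ⟨(LinearEquiv.ofInjectiveOfFinrankEq _ hinj hdim).toContinuousLinearEquiv, ?_⟩
  ext u v
  rfl

theorem IsInner.exists_basis {n : ℕ} (hn : finrank ℝ E = n) {G : E →L[ℝ] E →L[ℝ] ℝ}
    (hG : IsInner G) (M : E →ₗ[ℝ] E →ₗ[ℝ] ℝ) (hM : ∀ u v, M u v = M v u) :
    ∃ (b : Basis (Fin n) ℝ E) (l : Fin n → ℝ),
      (∀ i j, G (b i) (b j) = if i = j then 1 else 0) ∧ ∀ i v, M (b i) v = l i * G (b i) v :=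
  exists_basis_diagonal hn
    ((ContinuousLinearMap.coeLM ℝ : (E →L[ℝ] ℝ) →ₗ[ℝ] E →ₗ[ℝ] ℝ) ∘ₗ (G : E →ₗ[ℝ] E →L[ℝ] ℝ)) M
    hG.symm hG.pos hM

section Orthonormal

variable {n : ℕ} {b : Basis (Fin n) ℝ E} {G : E →L[ℝ] E →L[ℝ] ℝ}

theorem trace_inverse_comp (hG : IsInner G)
    (hb : ∀ i j, G (b i) (b j) = if i = j then 1 else 0) (X : E →L[ℝ] E →L[ℝ] ℝ) :
    LinearMap.trace ℝ E (G.inverse ∘L X : E →L[ℝ] E) = ∑ i, X (b i) (b i) := by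
  rw [trace_of_orthonormal hb]
  exact Finset.sum_congr rfl fun i _ => by
    simp [hG.isInvertible.self_apply_inverse]

end Orthonormal

variable {n : ℕ} {G M X Y : E →L[ℝ] E →L[ℝ] ℝ}

/-- The linearized contracted Gauss equation is injective in dimension at least three. -/
theorem eq_zero_of_gaussLin_eq_zero (hn : finrank ℝ E = n) (h3 : 3 ≤ n) (hG : IsInner G)
    (hM : IsInner M) (h : gaussLin G M X = 0) : X = 0 := by
  obtain ⟨b, l, hb, hl⟩ := hG.exists_basis hn
    ((ContinuousLinearMap.coeLM ℝ : (E →L[ℝ] ℝ) →ₗ[ℝ] E →ₗ[ℝ] ℝ) ∘ₗ (M : E →ₗ[ℝ] E →L[ℝ] ℝ))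
    hM.symm
  replace hl : ∀ i v, M (b i) v = l i * G (b i) v := hl
  have hlpos : ∀ i, 0 < l i := fun i => by
    have := hM.pos (b i) (b.ne_zero i)
    rwa [hl, hb, if_pos rfl, mul_one] at this
  have hshape : ∀ i, G.inverse (M (b i)) = l i • b i := fun i => by
    rw [hG.isInvertible.inverse_apply_eq]
    ext v
    simp [hl]
  have hMl : ∀ i, M (b i) (b i) = l i := fun i => by simp [hl, hb]
  -- In a basis diagonalizing M the linearized equation decouples. An off-diagonal entry is
  -- multiplied by H − lᵢ − lⱼ > 0, and the diagonal entries satisfy the scalar system. Symmetry of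
  -- X is never needed, so the implicit function theorem can be applied on all bilinear forms.
  have hcomp : ∀ i j, (∑ k, X (b k) (b k)) * (l i * if i = j then 1 else 0) +
      (∑ k, l k) * X (b i) (b j) - l j * X (b i) (b j) - X (b i) (b j) * l i = 0 := fun i j => by
    have h1 : gaussLin G M X (b i) (b j) = 0 := by rw [h]; rfl
    have h2 : M (G.inverse (X (b i))) (b j) = l j * X (b i) (b j) := by
      rw [hM.symm, hl, hG.symm, hG.isInvertible.self_apply_inverse]
    simp only [gaussLin, trace_inverse_comp hG hb, sub_apply,
      add_apply, smul_apply, smul_eq_mul,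
      ContinuousLinearMap.comp_apply, h2, hshape, map_smul, hMl] at h1
    rw [hl, hb] at h1
    linarith
  refine bilin_ext b fun i j => ?_
  simp only [zero_apply]
  by_cases hij : i = j
  · subst hij
    refine eq_zero_of_linearized_scalar h3 (x := fun i => X (b i) (b i)) hlpos (fun i => ?_) i
    have := hcomp i i
    simp only [if_true, mul_one] at this
    exact this
  · have := hcomp i j
    rw [if_neg hij, mul_zero, mul_zero, zero_add] at this
    have h2 := add_lt_sum_of_pos h3 hlpos hij
    have h4 : ((∑ k, l k) - l i - l j) * X (b i) (b j) = 0 := by linarith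
    exact (mul_eq_zero.1 h4).resolve_left fun h0 => by linarith

/-- Only X + Y has to be symmetric and positive definite. This allows a comparison of a possibly
nonsymmetric form with its own transpose. -/
theorem gaussMap_injective_of_add (hn : finrank ℝ E = n) (h3 : 3 ≤ n) (hG : IsInner G)
    (hXY : IsInner (X + Y)) (h : gaussMap G X = gaussMap G Y) : X = Y := by
  have h0 : gaussLin G (X + Y) (X - Y) = 0 := by
    rw [gaussMap_sub, h]
    ext u v
    change (2 : ℝ) * (gaussMap G Y u v - gaussMap G Y u v) = 0
    ring
  have h1 := eq_zero_of_gaussLin_eq_zero hn h3 hG hXY h0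
  ext u v
  have h2 : (X - Y) u v = 0 := by rw [h1]; rfl
  exact sub_eq_zero.1 h2

/-- The solution is sought diagonal in the given basis, with the entries supplied by the scalar
system. -/
theorem exists_gaussMap_eq (h3 : 3 ≤ n) (hG : IsInner G) {b : Basis (Fin n) ℝ E}
    (hb : ∀ i j, G (b i) (b j) = if i = j then 1 else 0) {r : Fin n → ℝ} (hr : ∀ i, 0 < r i)
    (hr2 : ∀ i, 2 * r i < ∑ k, r k) :
    ∃ X : E →L[ℝ] E →L[ℝ] ℝ, IsInner X ∧
      ∀ i j, gaussMap G X (b i) (b j) = if i = j then r i else 0 := by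
  obtain ⟨l, hl, hlr⟩ := exists_scalar_solution h3 hr hr2
  let X : E →L[ℝ] E →L[ℝ] ℝ := ∑ i, l i • (G (b i)).smulRight (G (b i))
  have hX : ∀ u v, X u v = ∑ i, l i * (G (b i) u * G (b i) v) := fun u v => by
    simp [X]
  have hXb : ∀ i, X (b i) = l i • G (b i) := fun i => by
    ext v
    rw [hX, Finset.sum_eq_single i]
    · simp [hb]
    · intro j _ hj
      simp [hb, hj]
    · simp
  refine ⟨X, ⟨fun u v => ?_, fun u hu => ?_⟩, fun i j => ?_⟩
  · rw [hX, hX]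
    exact Finset.sum_congr rfl fun i _ => by ring
  · rw [hX]
    obtain ⟨i, hi⟩ : ∃ i, G (b i) u ≠ 0 := by
      by_contra! h0
      refine hu (b.repr.map_eq_zero_iff.1 (Finsupp.ext fun i => ?_))
      rw [repr_of_orthonormal hb, hG.symm, h0, Finsupp.zero_apply]
    refine Finset.sum_pos' (fun j _ => mul_nonneg (hl j).le (mul_self_nonneg _))
      ⟨i, Finset.mem_univ i, mul_pos (hl i) (mul_self_pos.2 hi)⟩
  · have hshape : G.inverse (X (b i)) = l i • b i := by
      rw [hG.isInvertible.inverse_apply_eq, hXb]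
      simp
    have htr : ∑ k, X (b k) (b k) = ∑ k, l k :=
      Finset.sum_congr rfl fun k _ => by simp [hXb, hb]
    have h1 : gaussMap G X (b i) (b j) =
        (∑ k, X (b k) (b k)) * X (b i) (b j) - X (G.inverse (X (b i))) (b j) := by
      simp only [gaussMap, trace_inverse_comp hG hb]
      rfl
    have h2 : X (b i) (b j) = l i * if i = j then 1 else 0 := by
      rw [hXb, smul_apply, hb, smul_eq_mul]
    rw [h1, hshape, htr, map_smul, smul_apply, h2, ← hlr i, smul_eq_mul]
    split_ifs <;> ring

end Algebra

/-! ### Local Hölder classes `C^{k,α}` -/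

section Holder

universe u

variable {E F F' : Type u} [NormedAddCommGroup E] [NormedSpace ℝ E] [NormedAddCommGroup F]
  [NormedSpace ℝ F] [NormedAddCommGroup F'] [NormedSpace ℝ F'] {k : ℕ} {α : ℝ≥0}

/-- `f` is of class `C^{k,α}` near `x`. -/
def HolderAt (k : ℕ) (α : ℝ≥0) (f : E → F) (x : E) : Prop :=
  ContDiffAt ℝ k f x ∧ ∃ U ∈ 𝓝 x, ∃ C : ℝ≥0, HolderOnWith C α (iteratedFDeriv ℝ k f) U

theorem HolderAt.congr {f g : E → F} {x : E} (hf : HolderAt k α f x) (h : g =ᶠ[𝓝 x] f) :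
    HolderAt k α g x := by
  obtain ⟨h1, U, hU, C, hC⟩ := hf
  refine ⟨h1.congr_of_eventuallyEq h, _, inter_mem hU (h.iteratedFDeriv ℝ k), C, ?_⟩
  intro y hy z hz
  rw [hy.2, hz.2]
  exact hC y hy.1 z hz.1

theorem holderAt_zero_iff {f : E → F} {x : E} :
    HolderAt 0 α f x ↔ ContDiffAt ℝ 0 f x ∧ ∃ U ∈ 𝓝 x, ∃ C : ℝ≥0, HolderOnWith C α f U := by
  unfold HolderAt
  simp only [CharP.cast_eq_zero, iteratedFDeriv_zero_eq_comp, HolderOnWith, Function.comp_apply,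
    LinearIsometryEquiv.edist_map]

/-- The inductions on k run through this equivalence. They replace the target F by E →L[ℝ] F, which
is why all spaces share one universe. -/
theorem holderAt_succ_iff {f : E → F} {x : E} :
    HolderAt (k + 1) α f x ↔
      (∀ᶠ y in 𝓝 x, DifferentiableAt ℝ f y) ∧ HolderAt k α (fderiv ℝ f) x := by
  unfold HolderAt
  have hc : ContDiffAt ℝ ((k + 1 : ℕ) : WithTop ℕ∞) f x ↔
      (∀ᶠ y in 𝓝 x, DifferentiableAt ℝ f y) ∧ ContDiffAt ℝ k (fderiv ℝ f) x := by
    push_cast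
    constructor
    · intro h
      refine ⟨?_, h.fderiv_right le_rfl⟩
      filter_upwards [(h.of_le (by simp : (1 : WithTop ℕ∞) ≤ (k : WithTop ℕ∞) + 1)).eventually
        (by simp)] with y hy
      exact hy.differentiableAt one_ne_zero
    · rintro ⟨h1, h2⟩
      exact contDiffAt_succ_iff_hasFDerivAt.2 ⟨fderiv ℝ f,
        ⟨_, h1, fun y hy => DifferentiableAt.hasFDerivAt hy⟩, h2⟩
  rw [hc, and_assoc]
  have hs : ∀ y, iteratedFDeriv ℝ (k + 1) f y =
      (continuousMultilinearCurryRightEquiv' ℝ k E F).symm (iteratedFDeriv ℝ k (fderiv ℝ f) y) :=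
    fun y => iteratedFDeriv_succ_eq_comp_right
  simp only [HolderOnWith, hs, LinearIsometryEquiv.edist_map]

theorem exists_holderOnWith_of_contDiffAt {f : E → F} {x : E} (hα : α ≤ 1)
    (hf : ContDiffAt ℝ 1 f x) : ∃ U ∈ 𝓝 x, ∃ C : ℝ≥0, HolderOnWith C α f U := by
  obtain ⟨K, t, ht, hK⟩ := hf.exists_lipschitzOnWith
  refine ⟨t ∩ ball x 1, inter_mem ht (ball_mem_nhds x one_pos), _,
    -- A Lipschitz map is α-Hölder for α ≤ 1 on bounded sets; 2 bounds the diameter of the unit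
    -- ball.
    HolderOnWith.of_le (D := 2) (r := 1) (fun y hy z hz => ?_)
      (holderOnWith_one.2 (hK.mono Set.inter_subset_left)) hα⟩
  rw [edist_dist]
  refine ENNReal.ofReal_le_of_le_toReal ?_
  have h1 := mem_ball.1 hy.2
  have h2 := mem_ball'.1 hz.2
  have h3 := dist_triangle y x z
  simp only [ENNReal.coe_ofNat, ENNReal.toReal_ofNat]
  linarith

theorem holderAt_of_contDiffAt {f : E → F} {x : E} (hα : α ≤ 1)
    (hf : ContDiffAt ℝ (k + 1 : ℕ) f x) : HolderAt k α f x :=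
  ⟨hf.of_le (by exact_mod_cast k.le_succ), exists_holderOnWith_of_contDiffAt hα
    (hf.iteratedFDeriv_right (by push_cast; rw [add_comm]))⟩

theorem HolderAt.of_succ {f : E → F} {x : E} (hα : α ≤ 1) (hf : HolderAt (k + 1) α f x) :
    HolderAt k α f x :=
  holderAt_of_contDiffAt hα hf.1

theorem HolderAt.fderiv_right {f : E → F} {x : E} (hf : HolderAt (k + 1) α f x) :
    HolderAt k α (fderiv ℝ f) x :=
  (holderAt_succ_iff.1 hf).2

theorem HolderAt.clm_comp {f : E → F} {x : E} (hf : HolderAt k α f x) (L : F →L[ℝ] F') :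
    HolderAt k α (fun y => L (f y)) x := by
  refine ⟨L.contDiff.contDiffAt.comp x hf.1, ?_⟩
  obtain ⟨h1, U, hU, C, hC⟩ := hf
  have h2 : ∀ᶠ y in 𝓝 x, iteratedFDeriv ℝ k (fun y => L (f y)) y =
      ContinuousLinearMap.compContinuousMultilinearMapL ℝ (fun _ : Fin k => E) F F' L
        (iteratedFDeriv ℝ k f y) := by
    filter_upwards [h1.eventually (by simp)] with y hy
    exact L.iteratedFDeriv_comp_left hy le_rfl
  refine ⟨_, inter_mem hU h2, ‖ContinuousLinearMap.compContinuousMultilinearMapL ℝ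
    (fun _ : Fin k => E) F F' L‖₊ * C, fun y hy z hz => ?_⟩
  rw [hy.2, hz.2, ENNReal.coe_mul, mul_assoc]
  exact ((ContinuousLinearMap.compContinuousMultilinearMapL ℝ (fun _ : Fin k => E) F F'
    L).lipschitz _ _).trans (mul_le_mul_right (hC y hy.1 z hz.1) _)

theorem HolderAt.prodMk {f : E → F} {g : E → F'} {x : E} (hf : HolderAt k α f x)
    (hg : HolderAt k α g x) : HolderAt k α (fun y => (f y, g y)) x := by
  induction k generalizing F F' with
  | zero =>
    rw [holderAt_zero_iff] at *
    refine ⟨hf.1.prodMk hg.1, ?_⟩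
    obtain ⟨-, U, hU, C, hC⟩ := hf
    obtain ⟨-, V, hV, D, hD⟩ := hg
    refine ⟨U ∩ V, inter_mem hU hV, max C D, fun y hy z hz => ?_⟩
    rw [Prod.edist_eq]
    refine max_le ((hC y hy.1 z hz.1).trans ?_) ((hD y hy.2 z hz.2).trans ?_)
    · gcongr
      exact le_max_left _ _
    · gcongr
      exact le_max_right _ _
  | succ k ih =>
    have hf' := holderAt_succ_iff.1 hf
    have hg' := holderAt_succ_iff.1 hg
    refine holderAt_succ_iff.2 ⟨?_, ?_⟩
    · filter_upwards [hf'.1, hg'.1] with y h1 h2 using h1.prodMk h2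
    · refine ((ih hf'.2 hg'.2).clm_comp
        (ContinuousLinearMap.prodₗᵢ (𝕜 := ℝ) (E := E) (F := F) (G := F')
          ℝ).toContinuousLinearEquiv.toContinuousLinearMap).congr ?_
      filter_upwards [hf'.1, hg'.1] with y h1 h2
      exact (h1.hasFDerivAt.prodMk h2.hasFDerivAt).fderiv

/-- Induction by the chain rule: D(Φ ∘ f) is the composition product of DΦ ∘ f and Df. One
derivative beyond k on Φ makes its derivatives up to order k locally Lipschitz. -/
theorem HolderAt.contDiffAt_comp {f : E → F} {Φ : F → F'} {x : E} (hα : α ≤ 1)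
    (hf : HolderAt k α f x) (hΦ : ContDiffAt ℝ (k + 1 : ℕ) Φ (f x)) :
    HolderAt k α (fun y => Φ (f y)) x := by
  induction k generalizing F F' with
  | zero =>
    rw [holderAt_zero_iff] at *
    have hfc : ContinuousAt f x := hf.1.continuousAt
    refine ⟨(hΦ.of_le (by simp)).comp x hf.1, ?_⟩
    obtain ⟨-, U, hU, C, hC⟩ := hf
    obtain ⟨K, t, ht, hK⟩ := (hΦ.of_le (by simp) : ContDiffAt ℝ 1 Φ (f x)).exists_lipschitzOnWith
    refine ⟨U ∩ f ⁻¹' t, inter_mem hU (hfc ht), K * C, fun y hy z hz => ?_⟩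
    rw [ENNReal.coe_mul, mul_assoc]
    exact (hK hy.2 hz.2).trans (mul_le_mul_right (hC y hy.1 z hz.1) _)
  | succ k ih =>
    have hf' := holderAt_succ_iff.1 hf
    have hfc : ContinuousAt f x := hf.1.continuousAt
    have hΦd : ∀ᶠ z in 𝓝 (f x), DifferentiableAt ℝ Φ z := by
      filter_upwards [(hΦ.of_le (by exact_mod_cast Nat.le_add_left 1 _) :
        ContDiffAt ℝ 1 Φ (f x)).eventually (by simp)] with z hz
      exact hz.differentiableAt one_ne_zero
    have hev := hfc.eventually hΦd
    refine holderAt_succ_iff.2 ⟨?_, ?_⟩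
    · filter_upwards [hf'.1, hev] with y h1 h2 using h2.comp y h1
    · have h1 : HolderAt k α (fun y => fderiv ℝ Φ (f y)) x :=
        ih (hf.of_succ hα) (hΦ.fderiv_right (by push_cast; exact le_rfl))
      have h2 := ih (Φ := fun p : (F →L[ℝ] F') × (E →L[ℝ] F) => p.1 ∘L p.2)
        (h1.prodMk hf'.2) (isBoundedBilinearMap_comp.contDiff.contDiffAt)
      refine h2.congr ?_
      filter_upwards [hf'.1, hev] with y h1 h2
      exact fderiv_fun_comp y h2 h1

theorem HolderAt.clm_apply {f : E → F →L[ℝ] F'} {g : E → F} {x : E} (hα : α ≤ 1)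
    (hf : HolderAt k α f x) (hg : HolderAt k α g x) : HolderAt k α (fun y => f y (g y)) x :=
  (hf.prodMk hg).contDiffAt_comp (Φ := fun p : (F →L[ℝ] F') × F => p.1 p.2) hα
    isBoundedBilinearMap_apply.contDiff.contDiffAt

theorem HolderAt.add {f g : E → F} {x : E} (hf : HolderAt k α f x) (hg : HolderAt k α g x) :
    HolderAt k α (fun y => f y + g y) x :=
  (hf.prodMk hg).clm_comp (ContinuousLinearMap.fst ℝ F F + ContinuousLinearMap.snd ℝ F F)

theorem HolderAt.sub {f g : E → F} {x : E} (hf : HolderAt k α f x) (hg : HolderAt k α g x) :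
    HolderAt k α (fun y => f y - g y) x :=
  (hf.prodMk hg).clm_comp (ContinuousLinearMap.fst ℝ F F - ContinuousLinearMap.snd ℝ F F)

theorem holderAt_const (hα : α ≤ 1) (c : F) (x : E) : HolderAt k α (fun _ => c) x :=
  holderAt_of_contDiffAt hα contDiffAt_const

theorem HolderAt.sum {ι : Type*} {s : Finset ι} {f : ι → E → F} {x : E} (hα : α ≤ 1)
    (hf : ∀ i ∈ s, HolderAt k α (f i) x) : HolderAt k α (fun y => ∑ i ∈ s, f i y) x := by
  classical
  induction s using Finset.induction_on with
  | empty => simpa using holderAt_const hα (0 : F) x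
  | insert i s hi ih =>
    simp only [Finset.sum_insert hi]
    exact (hf i (by simp)).add (ih fun j hj => hf j (by simp [hj]))

end Holder

/-! ### The Christoffel symbols as a bilinear map -/

theorem hasFDerivAt_apply_const {A B F : Type*} [NormedAddCommGroup A] [NormedSpace ℝ A]
    [NormedAddCommGroup B] [NormedSpace ℝ B] [NormedAddCommGroup F] [NormedSpace ℝ F]
    {T : F → A →L[ℝ] B} {T' : F →L[ℝ] A →L[ℝ] B} {y : F} (h : HasFDerivAt T T' y) (a : A) :
    HasFDerivAt (fun t => T t a) (T'.flip a) y := by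
  simpa using h.clm_apply (hasFDerivAt_const a y)

section Local

variable {n : ℕ}

/-- The exchange of the two arguments of a bilinear map, as a continuous linear map. -/
def flipCLM (F : Type*) [NormedAddCommGroup F] [NormedSpace ℝ F] :
    (Coord n →L[ℝ] Coord n →L[ℝ] F) →L[ℝ] Coord n →L[ℝ] Coord n →L[ℝ] F :=
  (ContinuousLinearMap.flipₗᵢ ℝ (Coord n) (Coord n) F).toContinuousLinearEquiv

/-- The Christoffel symbols of the first kind as a continuous linear function of the derivative
`D u v w = ∂_u G (v, w)` of the metric. -/
def lowerChristoffelL : (Coord n →L[ℝ] Coord n →L[ℝ] Coord n →L[ℝ] ℝ) →L[ℝ]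
    Coord n →L[ℝ] Coord n →L[ℝ] Coord n →L[ℝ] ℝ :=
  (1 / 2 : ℝ) • (ContinuousLinearMap.id ℝ _ +
    flipCLM (Coord n →L[ℝ] ℝ) -
    (ContinuousLinearMap.compL ℝ (Coord n) (Coord n →L[ℝ] Coord n →L[ℝ] ℝ)
      (Coord n →L[ℝ] Coord n →L[ℝ] ℝ) (flipCLM ℝ)) ∘L
      flipCLM (Coord n →L[ℝ] ℝ))

/-- The Christoffel symbols as a function of the metric and its derivative. -/
def christoffelOf (p : (Coord n →L[ℝ] Coord n →L[ℝ] ℝ) ×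
    (Coord n →L[ℝ] Coord n →L[ℝ] Coord n →L[ℝ] ℝ)) : Coord n →L[ℝ] Coord n →L[ℝ] Coord n :=
  (ContinuousLinearMap.compL ℝ (Coord n) (Coord n →L[ℝ] ℝ) (Coord n) p.1.inverse) ∘L
    lowerChristoffelL p.2

/-- The Christoffel symbols as a bilinear map depending on the point. -/
def christoffelMap (G : Coord n → Coord n →L[ℝ] Coord n →L[ℝ] ℝ) (y : Coord n) :
    Coord n →L[ℝ] Coord n →L[ℝ] Coord n :=
  christoffelOf (G y, fderiv ℝ G y)

variable {G : Coord n → Coord n →L[ℝ] Coord n →L[ℝ] ℝ} {y : Coord n}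

theorem lowerChristoffelL_apply (D : Coord n →L[ℝ] Coord n →L[ℝ] Coord n →L[ℝ] ℝ)
    (u v w : Coord n) :
    lowerChristoffelL D u v w = 1 / 2 * (D u v w + D v u w - D w u v) := rfl

theorem christoffel_eq (G : Coord n → Coord n →L[ℝ] Coord n →L[ℝ] ℝ) (y u v : Coord n) :
    christoffel G y u v = christoffelMap G y u v := rfl

theorem contDiffAt_inverse {X : Coord n →L[ℝ] Coord n →L[ℝ] ℝ} (hX : X.IsInvertible)
    (m : WithTop ℕ∞) : ContDiffAt ℝ m ContinuousLinearMap.inverse X := by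
  obtain ⟨e, rfl⟩ := hX
  exact contDiffAt_map_inverse e

theorem contDiffAt_christoffelOf {p : (Coord n →L[ℝ] Coord n →L[ℝ] ℝ) ×
    (Coord n →L[ℝ] Coord n →L[ℝ] Coord n →L[ℝ] ℝ)} (hp : IsInner p.1) (m : WithTop ℕ∞) :
    ContDiffAt ℝ m christoffelOf p := by
  have h1 : ContDiffAt ℝ m (fun q : (Coord n →L[ℝ] Coord n →L[ℝ] ℝ) ×
      (Coord n →L[ℝ] Coord n →L[ℝ] Coord n →L[ℝ] ℝ) => q.1.inverse) p :=
    (contDiffAt_inverse hp.isInvertible m).comp p contDiffAt_fst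
  have h2 : ContDiffAt ℝ m (fun q : (Coord n →L[ℝ] Coord n →L[ℝ] ℝ) ×
      (Coord n →L[ℝ] Coord n →L[ℝ] Coord n →L[ℝ] ℝ) => lowerChristoffelL q.2) p :=
    lowerChristoffelL.contDiff.contDiffAt.comp p contDiffAt_snd
  exact ((ContinuousLinearMap.contDiff _).contDiffAt.comp p h1).clm_comp h2

/-- `G` is a Riemannian metric of class `C²` near `y`. -/
structure IsMetricAt (G : Coord n → Coord n →L[ℝ] Coord n →L[ℝ] ℝ) (y : Coord n) : Prop where
  contDiffAt : ContDiffAt ℝ 2 G y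
  isInner : ∀ᶠ z in 𝓝 y, IsInner (G z)

/-! ### Symmetries of the Christoffel symbols and of the curvature tensor -/

namespace IsMetricAt

theorem self (h : IsMetricAt G y) : IsInner (G y) := h.isInner.self_of_nhds

theorem eventually (h : IsMetricAt G y) : ∀ᶠ z in 𝓝 y, IsMetricAt G z := by
  filter_upwards [h.contDiffAt.eventually (by simp), h.isInner.eventually_nhds] with z h1 h2
  exact ⟨h1, h2⟩

theorem differentiableAt (h : IsMetricAt G y) : DifferentiableAt ℝ G y :=
  h.contDiffAt.differentiableAt two_ne_zero

theorem contDiffAt_fderiv (h : IsMetricAt G y) : ContDiffAt ℝ 1 (fderiv ℝ G) y :=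
  h.contDiffAt.fderiv_right (by norm_num)

theorem differentiableAt_fderiv (h : IsMetricAt G y) : DifferentiableAt ℝ (fderiv ℝ G) y :=
  h.contDiffAt_fderiv.differentiableAt one_ne_zero

theorem differentiableAt_christoffelMap (h : IsMetricAt G y) :
    DifferentiableAt ℝ (christoffelMap G) y := by
  have h1 := contDiffAt_christoffelOf (p := (G y, fderiv ℝ G y)) h.self 1
  exact (h1.comp y ((h.contDiffAt.of_le one_le_two).prodMk
    h.contDiffAt_fderiv)).differentiableAt one_ne_zero

theorem fderiv_symm (h : IsMetricAt G y) (u v w : Coord n) :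
    fderiv ℝ G y u v w = fderiv ℝ G y u w v := by
  have h1 : (fun z => G z v w) =ᶠ[𝓝 y] fun z => G z w v := by
    filter_upwards [h.isInner] with z hz using hz.symm v w
  have h2 := fun a b => hasFDerivAt_apply_const
    (hasFDerivAt_apply_const h.differentiableAt.hasFDerivAt a) b
  have h3 := ((h2 w v).congr_of_eventuallyEq h1).unique (h2 v w)
  exact (congrArg (fun T : Coord n →L[ℝ] ℝ => T u) h3).symm

theorem fderiv_fderiv_comm (h : IsMetricAt G y) (u v : Coord n) :
    fderiv ℝ (fderiv ℝ G) y u v = fderiv ℝ (fderiv ℝ G) y v u :=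
  h.contDiffAt.isSymmSndFDerivAt (by simp) u v

theorem fderiv_fderiv_symm (h : IsMetricAt G y) (t u v w : Coord n) :
    fderiv ℝ (fderiv ℝ G) y t u v w = fderiv ℝ (fderiv ℝ G) y t u w v := by
  have h1 : (fun z => fderiv ℝ G z u v w) =ᶠ[𝓝 y] fun z => fderiv ℝ G z u w v := by
    filter_upwards [h.eventually] with z hz using hz.fderiv_symm u v w
  have h2 := fun a b => hasFDerivAt_apply_const (hasFDerivAt_apply_const
    (hasFDerivAt_apply_const h.differentiableAt_fderiv.hasFDerivAt u) a) b
  have h3 := ((h2 w v).congr_of_eventuallyEq h1).unique (h2 v w)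
  exact (congrArg (fun T : Coord n →L[ℝ] ℝ => T t) h3).symm

theorem metric_christoffel (h : IsMetricAt G y) (u v w : Coord n) :
    G y (christoffelMap G y u v) w =
      1 / 2 * (fderiv ℝ G y u v w + fderiv ℝ G y v u w - fderiv ℝ G y w u v) := by
  have : G y (christoffelMap G y u v) = lowerChristoffelL (fderiv ℝ G y) u v :=
    h.self.isInvertible.self_apply_inverse _
  rw [this, lowerChristoffelL_apply]

theorem christoffel_symm (h : IsMetricAt G y) (u v : Coord n) :
    christoffelMap G y u v = christoffelMap G y v u := by
  have hinj : Function.Injective (G y) := h.self.isInvertible.injective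
  refine hinj ?_
  ext w
  rw [h.metric_christoffel, h.metric_christoffel, h.fderiv_symm w u v]
  ring

theorem fderiv_christoffel (h : IsMetricAt G y) (u v w : Coord n) :
    fderiv ℝ (fun z => christoffel G z v w) y u = fderiv ℝ (christoffelMap G) y u v w := by
  have h2 := hasFDerivAt_apply_const
    (hasFDerivAt_apply_const h.differentiableAt_christoffelMap.hasFDerivAt v) w
  simp only [christoffel_eq]
  rw [h2.fderiv]
  rfl

theorem riemann_eq (h : IsMetricAt G y) (u v w : Coord n) :
    riemann G y u v w = fderiv ℝ (christoffelMap G) y u v w - fderiv ℝ (christoffelMap G) y v u w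
      + christoffelMap G y u (christoffelMap G y v w)
      - christoffelMap G y v (christoffelMap G y u w) := by
  unfold riemann
  rw [h.fderiv_christoffel, h.fderiv_christoffel]
  rfl

/-- Differentiating the identity for G(Γ(v, w), z) avoids differentiating the inverse metric. -/
theorem metric_fderiv_christoffel (h : IsMetricAt G y) (u v w z : Coord n) :
    G y (fderiv ℝ (christoffelMap G) y u v w) z =
      1 / 2 * (fderiv ℝ (fderiv ℝ G) y u v w z + fderiv ℝ (fderiv ℝ G) y u w v z -
        fderiv ℝ (fderiv ℝ G) y u z v w) - fderiv ℝ G y u (christoffelMap G y v w) z := by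
  have h1 : (fun t => G t (christoffelMap G t v w) z) =ᶠ[𝓝 y]
      fun t => lowerChristoffelL (fderiv ℝ G t) v w z := by
    filter_upwards [h.eventually] with t ht
    rw [ht.metric_christoffel, lowerChristoffelL_apply]
  have hΓ := hasFDerivAt_apply_const
    (hasFDerivAt_apply_const h.differentiableAt_christoffelMap.hasFDerivAt v) w
  have h2 := hasFDerivAt_apply_const (h.differentiableAt.hasFDerivAt.clm_apply hΓ) z
  have h3 := hasFDerivAt_apply_const (hasFDerivAt_apply_const (hasFDerivAt_apply_const
    ((ContinuousLinearMap.hasFDerivAt lowerChristoffelL).comp y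
      h.differentiableAt_fderiv.hasFDerivAt) v) w) z
  have h4 := congrArg (fun T : Coord n →L[ℝ] ℝ => T u) ((h3.congr_of_eventuallyEq h1).unique h2)
  simp only [ContinuousLinearMap.flip_apply, ContinuousLinearMap.comp_apply, add_apply,
    lowerChristoffelL_apply] at h4
  linarith

/-- The curvature tensor with all indices lowered. -/
theorem metric_riemann (h : IsMetricAt G y) (u v w z : Coord n) :
    G y (riemann G y u v w) z =
      1 / 2 * (fderiv ℝ (fderiv ℝ G) y u w v z - fderiv ℝ (fderiv ℝ G) y u z v w -
        fderiv ℝ (fderiv ℝ G) y v w u z + fderiv ℝ (fderiv ℝ G) y v z u w) -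
      G y (christoffelMap G y u z) (christoffelMap G y v w) +
      G y (christoffelMap G y v z) (christoffelMap G y u w) := by
  rw [h.riemann_eq]
  simp only [map_add, map_sub, add_apply, sub_apply, h.metric_fderiv_christoffel,
    h.metric_christoffel]
  -- The term −∂ᵤG(Γ(v, w), z) together with G(Γ(u, Γ(v, w)), z) gives −G(Γ(u, z), Γ(v, w)), and
  -- likewise with u and v exchanged.
  rw [h.fderiv_fderiv_comm u v, h.fderiv_symm u z, h.fderiv_symm v z]
  ring

theorem metric_riemann_pair_symm (h : IsMetricAt G y) (u v w z : Coord n) :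
    G y (riemann G y u v w) z = G y (riemann G y w z u) v := by
  rw [h.metric_riemann, h.metric_riemann, h.fderiv_fderiv_comm w u, h.fderiv_fderiv_comm w v,
    h.fderiv_fderiv_comm z u, h.fderiv_fderiv_comm z v, h.fderiv_fderiv_symm u w v z,
    h.fderiv_fderiv_symm v w u z, h.fderiv_fderiv_symm u z v w, h.fderiv_fderiv_symm v z u w,
    h.christoffel_symm z u, h.christoffel_symm w v, h.christoffel_symm w u,
    h.christoffel_symm z v]
  linarith [h.self.symm (christoffelMap G y u z) (christoffelMap G y v w)]

theorem metric_riemann_antisymm (h : IsMetricAt G y) (u v w z : Coord n) :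
    G y (riemann G y u v w) z = - G y (riemann G y v u w) z := by
  rw [h.metric_riemann, h.metric_riemann]
  ring

end IsMetricAt

end Local

/-! ### The Ricci curvature in coordinates -/

section Local

variable {n : ℕ} {G : Coord n → Coord n →L[ℝ] Coord n →L[ℝ] ℝ} {y : Coord n}

namespace IsMetricAt

theorem eq_of_metric_eq (h : IsMetricAt G y) {a b : Coord n} (hab : ∀ z, G y a z = G y b z) :
    a = b :=
  h.self.isInvertible.injective (ContinuousLinearMap.ext hab)

theorem riemann_add_left (h : IsMetricAt G y) (u u' v w : Coord n) :
    riemann G y (u + u') v w = riemann G y u v w + riemann G y u' v w := by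
  simp only [h.riemann_eq, map_add, add_apply]
  abel

theorem riemann_smul_left (h : IsMetricAt G y) (c : ℝ) (u v w : Coord n) :
    riemann G y (c • u) v w = c • riemann G y u v w := by
  simp only [h.riemann_eq, map_smul, smul_apply, smul_add, smul_sub]

theorem riemann_add_middle (h : IsMetricAt G y) (u v v' w : Coord n) :
    riemann G y u (v + v') w = riemann G y u v w + riemann G y u v' w := by
  simp only [h.riemann_eq, map_add, add_apply]
  abel

theorem riemann_smul_middle (h : IsMetricAt G y) (c : ℝ) (u v w : Coord n) :
    riemann G y u (c • v) w = c • riemann G y u v w := by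
  simp only [h.riemann_eq, map_smul, smul_apply, smul_add, smul_sub]

theorem riemann_add_right (h : IsMetricAt G y) (u v w w' : Coord n) :
    riemann G y u v (w + w') = riemann G y u v w + riemann G y u v w' := by
  simp only [h.riemann_eq, map_add]
  abel

theorem riemann_smul_right (h : IsMetricAt G y) (c : ℝ) (u v w : Coord n) :
    riemann G y u v (c • w) = c • riemann G y u v w := by
  simp only [h.riemann_eq, map_smul, smul_add, smul_sub]

/-- The endomorphism `u ↦ R(u, v) w`. -/
def riemannEnd (h : IsMetricAt G y) (v w : Coord n) : Coord n →ₗ[ℝ] Coord n where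
  toFun u := riemann G y u v w
  map_add' u u' := h.riemann_add_left u u' v w
  map_smul' c u := h.riemann_smul_left c u v w

/-- The Ricci curvature as a bilinear form. -/
def ricciForm (h : IsMetricAt G y) : Coord n →ₗ[ℝ] Coord n →ₗ[ℝ] ℝ :=
  LinearMap.mk₂ ℝ (ricciLocal G y)
    (fun v v' w => by
      simp only [ricciLocal, h.riemann_add_middle, PiLp.add_apply, Finset.sum_add_distrib])
    (fun c v w => by
      simp only [ricciLocal, h.riemann_smul_middle, PiLp.smul_apply, Finset.smul_sum])
    (fun v w w' => by
      simp only [ricciLocal, h.riemann_add_right, PiLp.add_apply, Finset.sum_add_distrib])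
    (fun c v w => by
      simp only [ricciLocal, h.riemann_smul_right, PiLp.smul_apply, Finset.smul_sum])

theorem ricciForm_apply (h : IsMetricAt G y) (v w : Coord n) :
    h.ricciForm v w = ricciLocal G y v w := rfl

theorem ricciLocal_eq_trace (h : IsMetricAt G y) (v w : Coord n) :
    ricciLocal G y v w = LinearMap.trace ℝ (Coord n) (h.riemannEnd v w) := by
  rw [LinearMap.trace_eq_matrix_trace ℝ (EuclideanSpace.basisFun (Fin n) ℝ).toBasis, Matrix.trace]
  refine Finset.sum_congr rfl fun i _ => ?_
  simp [LinearMap.toMatrix_apply, riemannEnd]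

theorem ricciLocal_eq_sum (h : IsMetricAt G y) {b : Basis (Fin n) ℝ (Coord n)}
    (hb : ∀ i j, G y (b i) (b j) = if i = j then 1 else 0) (v w : Coord n) :
    ricciLocal G y v w = ∑ i, G y (riemann G y (b i) v w) (b i) := by
  rw [h.ricciLocal_eq_trace, trace_of_orthonormal hb]
  rfl

theorem ricciLocal_symm (h : IsMetricAt G y) (v w : Coord n) :
    ricciLocal G y v w = ricciLocal G y w v := by
  obtain ⟨b, -, hb, -⟩ := h.self.exists_basis (finrank_euclideanSpace_fin (𝕜 := ℝ) (n := n)) 0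
    (fun _ _ => rfl)
  rw [h.ricciLocal_eq_sum hb, h.ricciLocal_eq_sum hb]
  refine Finset.sum_congr rfl fun i _ => ?_
  linarith [h.metric_riemann_pair_symm (b i) v w (b i), h.metric_riemann_antisymm w (b i) (b i) v,
    h.metric_riemann_pair_symm (b i) w (b i) v, h.metric_riemann_antisymm (b i) v (b i) w,
    h.metric_riemann_pair_symm v (b i) (b i) w]

/-- The contracted Gauss equation can be solved at a point with positive sectional curvature. -/
theorem exists_isInner_gaussMap_eq (h : IsMetricAt G y) (hn : 3 ≤ n)
    (hK : ∀ u v : Coord n, LinearIndependent ℝ ![u, v] → 0 < G y (riemann G y u v v) u) :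
    ∃ X : Coord n →L[ℝ] Coord n →L[ℝ] ℝ, IsInner X ∧
      ∀ u v, ricciLocal G y u v = gaussMap (G y) X u v := by
  obtain ⟨b, r, hb, hr⟩ := h.self.exists_basis (finrank_euclideanSpace_fin (𝕜 := ℝ) (n := n))
    h.ricciForm h.ricciLocal_symm
  have hrb : ∀ i j, ricciLocal G y (b i) (b j) = if i = j then r i else 0 := fun i j => by
    rw [← h.ricciForm_apply, hr, hb]
    split_ifs <;> simp
  -- The sectional curvatures of the coordinate planes of the orthonormal eigenbasis; their column
  -- sums are the Ricci eigenvalues.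
  set K : Fin n → Fin n → ℝ := fun i j => G y (riemann G y (b i) (b j) (b j)) (b i) with hKdef
  have hKr : ∀ j, r j = ∑ i, K i j := fun j => by
    have h1 := hrb j j
    rw [if_pos rfl, h.ricciLocal_eq_sum hb] at h1
    exact h1.symm
  have hK0 : ∀ i, K i i = 0 := fun i => by
    have := h.metric_riemann_antisymm (b i) (b i) (b i) (b i)
    simp only [hKdef]
    linarith
  have hKpos : ∀ i j, i ≠ j → 0 < K i j := fun i j hij => by
    refine hK _ _ ?_
    have := b.linearIndependent.comp ![i, j] (by
      intro a a' haa'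
      fin_cases a <;> fin_cases a' <;> simp_all)
    have he : ![b i, b j] = b ∘ ![i, j] := by
      ext a : 1
      fin_cases a <;> rfl
    rw [he]
    exact this
  have hKsymm : ∀ i j, K i j = K j i := fun i j => by
    simp only [hKdef]
    rw [h.metric_riemann_pair_symm]
  have hKnn : ∀ i j, 0 ≤ K i j := fun i j => by
    by_cases hij : i = j
    · rw [hij, hK0]
    · exact (hKpos i j hij).le
  have hne : ∀ i : Fin n, ∃ j, j ≠ i := fun i => by
    have : Nontrivial (Fin n) := Fin.nontrivial_iff_two_le.2 (by omega)
    exact exists_ne i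
  have hrpos : ∀ i, 0 < r i := fun i => by
    rw [hKr]
    obtain ⟨j, hj⟩ := hne i
    exact Finset.sum_pos' (fun k _ => hKnn k i) ⟨j, Finset.mem_univ j, hKpos j i hj⟩
  -- After cancelling one rᵢ, compare rᵢ = ∑ Kᵢₖ with ∑ rₖ, both over k ≠ i. Termwise Kᵢₖ < rₖ,
  -- since rₖ also contains Kₘₖ > 0 for a third index m.
  have hr2 : ∀ i, 2 * r i < ∑ k, r k := fun i => by
    rw [← Finset.add_sum_erase _ _ (Finset.mem_univ i), two_mul, add_lt_add_iff_left]
    have h1 : r i = ∑ k ∈ Finset.univ.erase i, K i k := by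
      rw [hKr, ← Finset.add_sum_erase _ _ (Finset.mem_univ i), hK0, zero_add]
      exact Finset.sum_congr rfl fun k _ => hKsymm k i
    rw [h1]
    refine Finset.sum_lt_sum_of_nonempty ?_ fun k hk => ?_
    · obtain ⟨j, hj⟩ := hne i
      exact ⟨j, by simp [hj]⟩
    · have hki : k ≠ i := Finset.ne_of_mem_erase hk
      obtain ⟨m, hm⟩ := exists_notMem_pair hn i k
      simp only [Finset.mem_insert, Finset.mem_singleton, not_or] at hm
      have h2 : K i k + K m k ≤ ∑ l, K l k := by
        rw [← Finset.sum_pair (f := fun l => K l k) (Ne.symm hm.1)]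
        exact Finset.sum_le_sum_of_subset_of_nonneg (Finset.subset_univ _)
          fun l _ _ => hKnn l k
      rw [hKr]
      linarith [hKpos m k hm.2]
  obtain ⟨X, hX, hXr⟩ := exists_gaussMap_eq hn h.self hb hrpos hr2
  refine ⟨X, hX, fun u v => ?_⟩
  have heq : h.ricciForm = (ContinuousLinearMap.coeLM ℝ : (Coord n →L[ℝ] ℝ) →ₗ[ℝ] _) ∘ₗ
      (gaussMap (G y) X : Coord n →ₗ[ℝ] Coord n →L[ℝ] ℝ) :=
    b.ext fun i => b.ext fun j => (hrb i j).trans (hXr i j).symm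
  exact congrArg (fun T : Coord n →ₗ[ℝ] Coord n →ₗ[ℝ] ℝ => T u v) heq

end IsMetricAt

/-! ### Hölder regularity of the Ricci curvature -/

variable {k : ℕ} {α : ℝ≥0}

theorem HolderAt.christoffelMap (hα : α ≤ 1) (hG : HolderAt (k + 1) α G y)
    (hi : IsInner (G y)) : HolderAt k α (christoffelMap G) y :=
  ((hG.of_succ hα).prodMk hG.fderiv_right).contDiffAt_comp
    (Φ := christoffelOf) hα (contDiffAt_christoffelOf hi _)

theorem HolderAt.riemann (hα : α ≤ 1) (hG : HolderAt (k + 2) α G y) (hi : IsInner (G y))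
    (u v w : Coord n) : HolderAt k α (fun z => riemann G z u v w) y := by
  have h1 : HolderAt (k + 1) α (SphereGauss.christoffelMap G) y := hG.christoffelMap hα hi
  have h0 := h1.of_succ hα
  have hc : ∀ {m : ℕ} (a : Coord n), HolderAt m α (fun _ : Coord n => a) y := fun a =>
    holderAt_const hα a y
  have hΓ : ∀ a b, HolderAt (k + 1) α (fun z => SphereGauss.christoffelMap G z a b) y := fun a b =>
    (h1.clm_apply hα (hc a)).clm_apply hα (hc b)
  have hD : ∀ a b c, HolderAt k α
      (fun z => fderiv ℝ (fun t => SphereGauss.christoffelMap G t a b) z c) y :=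
    fun a b c => (hΓ a b).fderiv_right.clm_apply hα (hc c)
  have hΓΓ : ∀ a b c, HolderAt k α (fun z => SphereGauss.christoffelMap G z a
      (SphereGauss.christoffelMap G z b c)) y := fun a b c => (h0.clm_apply hα (hc a)).clm_apply hα ((hΓ b c).of_succ hα)
  exact (((hD v w u).sub (hD u w v)).add (hΓΓ u v w)).sub (hΓΓ v u w)

theorem HolderAt.ricciLocal (hα : α ≤ 1) (hG : HolderAt (k + 2) α G y) (hi : IsInner (G y))
    (v w : Coord n) : HolderAt k α (fun z => ricciLocal G z v w) y :=
  HolderAt.sum hα fun i _ =>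
    (hG.riemann hα hi (EuclideanSpace.single i 1) v w).clm_comp (EuclideanSpace.proj i)

end Local

/-! ### Behaviour of the curvature under a change of coordinates -/

section Pullback

variable {n : ℕ} {G G' : Coord n → Coord n →L[ℝ] Coord n →L[ℝ] ℝ} {ψ : Coord n → Coord n}
  {y : Coord n}

/-- Near `y`, the metric `G'` is the pull-back of the metric `G` under `ψ`. -/
structure IsPullbackAt (ψ : Coord n → Coord n) (G' G : Coord n → Coord n →L[ℝ] Coord n →L[ℝ] ℝ)
    (y : Coord n) : Prop where
  contDiffAt : ContDiffAt ℝ 3 ψ y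
  source : IsMetricAt G' y
  target : IsMetricAt G (ψ y)
  eq : ∀ᶠ z in 𝓝 y, ∀ u v, G' z u v = G (ψ z) (fderiv ℝ ψ z u) (fderiv ℝ ψ z v)

/-! ### Transformation laws of the Christoffel symbols and the curvature -/

namespace IsPullbackAt

theorem eventually (h : IsPullbackAt ψ G' G y) : ∀ᶠ z in 𝓝 y, IsPullbackAt ψ G' G z := by
  filter_upwards [h.contDiffAt.eventually (by simp), h.source.eventually,
    h.contDiffAt.continuousAt.eventually h.target.eventually, h.eq.eventually_nhds]
    with z h1 h2 h3 h4
  exact ⟨h1, h2, h3, h4⟩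

theorem hasFDerivAt (h : IsPullbackAt ψ G' G y) : HasFDerivAt ψ (fderiv ℝ ψ y) y :=
  (h.contDiffAt.differentiableAt three_ne_zero).hasFDerivAt

theorem contDiffAt_fderiv (h : IsPullbackAt ψ G' G y) : ContDiffAt ℝ 2 (fderiv ℝ ψ) y :=
  h.contDiffAt.fderiv_right (by norm_num)

theorem hasFDerivAt_fderiv (h : IsPullbackAt ψ G' G y) :
    HasFDerivAt (fderiv ℝ ψ) (fderiv ℝ (fderiv ℝ ψ) y) y :=
  (h.contDiffAt_fderiv.differentiableAt two_ne_zero).hasFDerivAt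

theorem hasFDerivAt_fderiv_fderiv (h : IsPullbackAt ψ G' G y) :
    HasFDerivAt (fderiv ℝ (fderiv ℝ ψ)) (fderiv ℝ (fderiv ℝ (fderiv ℝ ψ)) y) y :=
  ((h.contDiffAt_fderiv.fderiv_right (m := 1) (by norm_num)).differentiableAt
    one_ne_zero).hasFDerivAt

theorem fderiv_fderiv_comm (h : IsPullbackAt ψ G' G y) (u v : Coord n) :
    fderiv ℝ (fderiv ℝ ψ) y u v = fderiv ℝ (fderiv ℝ ψ) y v u :=
  h.contDiffAt.isSymmSndFDerivAt (by simp; norm_num) u v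

theorem third_fderiv_comm (h : IsPullbackAt ψ G' G y) (u v : Coord n) :
    fderiv ℝ (fderiv ℝ (fderiv ℝ ψ)) y u v = fderiv ℝ (fderiv ℝ (fderiv ℝ ψ)) y v u :=
  h.contDiffAt_fderiv.isSymmSndFDerivAt (by simp) u v

theorem bijective (h : IsPullbackAt ψ G' G y) : Function.Bijective (fderiv ℝ ψ y) := by
  have hinj : Function.Injective (fderiv ℝ ψ y : Coord n →ₗ[ℝ] Coord n) := by
    rw [← LinearMap.ker_eq_bot, LinearMap.ker_eq_bot']
    intro u hu
    by_contra h0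
    have h1 := h.source.self.pos u h0
    have h2 : fderiv ℝ ψ y u = 0 := hu
    rw [h.eq.self_of_nhds, h2] at h1
    simp at h1
  exact ⟨hinj, LinearMap.injective_iff_surjective.1 hinj⟩

theorem fderiv_metric (h : IsPullbackAt ψ G' G y) (u v w : Coord n) :
    fderiv ℝ G' y u v w =
      fderiv ℝ G (ψ y) (fderiv ℝ ψ y u) (fderiv ℝ ψ y v) (fderiv ℝ ψ y w) +
      G (ψ y) (fderiv ℝ (fderiv ℝ ψ) y u v) (fderiv ℝ ψ y w) +
      G (ψ y) (fderiv ℝ ψ y v) (fderiv ℝ (fderiv ℝ ψ) y u w) := by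
  have h1 : (fun z => G' z v w) =ᶠ[𝓝 y]
      fun z => G (ψ z) (fderiv ℝ ψ z v) (fderiv ℝ ψ z w) := by
    filter_upwards [h.eq] with z hz using hz v w
  have hG : HasFDerivAt (fun z => G (ψ z)) (fderiv ℝ G (ψ y) ∘L fderiv ℝ ψ y) y :=
    h.target.differentiableAt.hasFDerivAt.comp y h.hasFDerivAt
  have h2 := (hG.clm_apply (hasFDerivAt_apply_const h.hasFDerivAt_fderiv v)).clm_apply
    (hasFDerivAt_apply_const h.hasFDerivAt_fderiv w)
  have h3 := hasFDerivAt_apply_const (hasFDerivAt_apply_const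
    h.source.differentiableAt.hasFDerivAt v) w
  have h4 := congrArg (fun T : Coord n →L[ℝ] ℝ => T u) (h3.unique (h2.congr_of_eventuallyEq h1))
  simp only [ContinuousLinearMap.flip_apply, ContinuousLinearMap.comp_apply, add_apply] at h4
  linarith

theorem christoffel (h : IsPullbackAt ψ G' G y) (u v : Coord n) :
    fderiv ℝ ψ y (christoffelMap G' y u v) = fderiv ℝ (fderiv ℝ ψ) y u v +
      christoffelMap G (ψ y) (fderiv ℝ ψ y u) (fderiv ℝ ψ y v) := by
  refine h.target.eq_of_metric_eq fun z => ?_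
  obtain ⟨w, rfl⟩ := h.bijective.2 z
  rw [← h.eq.self_of_nhds, h.source.metric_christoffel, map_add, add_apply,
    h.target.metric_christoffel, h.fderiv_metric, h.fderiv_metric, h.fderiv_metric,
    h.fderiv_fderiv_comm v u, h.fderiv_fderiv_comm w u, h.fderiv_fderiv_comm w v,
    h.target.self.symm (fderiv ℝ (fderiv ℝ ψ) y u w)]
  ring

theorem fderiv_christoffel (h : IsPullbackAt ψ G' G y) (u v w : Coord n) :
    fderiv ℝ (fderiv ℝ ψ) y u (christoffelMap G' y v w) +
      fderiv ℝ ψ y (fderiv ℝ (christoffelMap G') y u v w) =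
    fderiv ℝ (fderiv ℝ (fderiv ℝ ψ)) y u v w +
      (fderiv ℝ (christoffelMap G) (ψ y) (fderiv ℝ ψ y u) (fderiv ℝ ψ y v) (fderiv ℝ ψ y w) +
      christoffelMap G (ψ y) (fderiv ℝ (fderiv ℝ ψ) y u v) (fderiv ℝ ψ y w) +
      christoffelMap G (ψ y) (fderiv ℝ ψ y v) (fderiv ℝ (fderiv ℝ ψ) y u w)) := by
  have h1 : (fun z => fderiv ℝ ψ z (christoffelMap G' z v w)) =ᶠ[𝓝 y]
      fun z => fderiv ℝ (fderiv ℝ ψ) z v w +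
        christoffelMap G (ψ z) (fderiv ℝ ψ z v) (fderiv ℝ ψ z w) := by
    filter_upwards [h.eventually] with z hz using hz.christoffel v w
  have h2 := h.hasFDerivAt_fderiv.clm_apply (hasFDerivAt_apply_const (hasFDerivAt_apply_const
    h.source.differentiableAt_christoffelMap.hasFDerivAt v) w)
  have hΓ : HasFDerivAt (fun z => christoffelMap G (ψ z))
      (fderiv ℝ (christoffelMap G) (ψ y) ∘L fderiv ℝ ψ y) y :=
    h.target.differentiableAt_christoffelMap.hasFDerivAt.comp y h.hasFDerivAt
  have h3 := (hasFDerivAt_apply_const (hasFDerivAt_apply_const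
    h.hasFDerivAt_fderiv_fderiv v) w).add
    ((hΓ.clm_apply (hasFDerivAt_apply_const h.hasFDerivAt_fderiv v)).clm_apply
      (hasFDerivAt_apply_const h.hasFDerivAt_fderiv w))
  have h4 := congrArg (fun T : Coord n →L[ℝ] Coord n => T u)
    (h2.unique (h3.congr_of_eventuallyEq h1))
  simp only [ContinuousLinearMap.flip_apply, ContinuousLinearMap.comp_apply, add_apply] at h4
  rw [add_comm, h4]
  abel

/-- Apply dψ to ∂ₐΓ'(b, w) + Γ'(a, Γ'(b, w)). The terms in D³ψ and D²ψ are symmetric in a and b, so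
they vanish on antisymmetrizing; the rest is the same expression for G. -/
theorem riemann (h : IsPullbackAt ψ G' G y) (u v w : Coord n) :
    fderiv ℝ ψ y (riemann G' y u v w) =
      riemann G (ψ y) (fderiv ℝ ψ y u) (fderiv ℝ ψ y v) (fderiv ℝ ψ y w) := by
  have key : ∀ a b, fderiv ℝ ψ y (fderiv ℝ (christoffelMap G') y a b w) +
      fderiv ℝ ψ y (christoffelMap G' y a (christoffelMap G' y b w)) =
      fderiv ℝ (fderiv ℝ (fderiv ℝ ψ)) y a b w +
      fderiv ℝ (christoffelMap G) (ψ y) (fderiv ℝ ψ y a) (fderiv ℝ ψ y b) (fderiv ℝ ψ y w) +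
      christoffelMap G (ψ y) (fderiv ℝ (fderiv ℝ ψ) y a b) (fderiv ℝ ψ y w) +
      (christoffelMap G (ψ y) (fderiv ℝ ψ y b) (fderiv ℝ (fderiv ℝ ψ) y a w) +
      christoffelMap G (ψ y) (fderiv ℝ ψ y a) (fderiv ℝ (fderiv ℝ ψ) y b w)) +
      christoffelMap G (ψ y) (fderiv ℝ ψ y a)
        (christoffelMap G (ψ y) (fderiv ℝ ψ y b) (fderiv ℝ ψ y w)) := fun a b => by
    have h1 := h.fderiv_christoffel a b w
    rw [h.christoffel a, h.christoffel b w, map_add]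
    rw [add_comm] at h1
    rw [eq_sub_of_add_eq h1]
    abel
  have hu := key u v
  have hv := key v u
  rw [h.third_fderiv_comm v u, h.fderiv_fderiv_comm v u] at hv
  rw [h.source.riemann_eq, h.target.riemann_eq, map_sub, map_add, map_sub]
  have e : ∀ a b c d : Coord n, a - b + c - d = (a + c) - (b + d) := fun a b c d => by abel
  rw [e, hu, hv]
  abel

/-- dψ conjugates the two endomorphisms whose traces are the Ricci curvatures. -/
theorem ricciLocal (h : IsPullbackAt ψ G' G y) (v w : Coord n) :
    ricciLocal G' y v w = ricciLocal G (ψ y) (fderiv ℝ ψ y v) (fderiv ℝ ψ y w) := by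
  rw [h.source.ricciLocal_eq_trace, h.target.ricciLocal_eq_trace]
  let e : Coord n ≃ₗ[ℝ] Coord n :=
    LinearEquiv.ofBijective (fderiv ℝ ψ y : Coord n →ₗ[ℝ] Coord n) h.bijective
  rw [← LinearMap.trace_conj' (h.source.riemannEnd v w) e]
  congr 1
  ext1 z
  obtain ⟨u, rfl⟩ := e.surjective z
  rw [LinearEquiv.conj_apply_apply, e.symm_apply_apply]
  exact h.riemann u v w

end IsPullbackAt

end Pullback

/-! ### Charts of the sphere -/

section Charts

variable {n : ℕ}

theorem mfderiv_eq_comp_fderiv {M : Type*} [TopologicalSpace M] [ChartedSpace (Coord n) M]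
    {φ φ' : Coord n → M} {ψ : Coord n → Coord n} {z : Coord n} (h : φ =ᶠ[𝓝 z] φ' ∘ ψ)
    (hφ : MDifferentiableAt 𝓘(ℝ, Coord n) (𝓡 n) φ' (ψ z)) (hψ : DifferentiableAt ℝ ψ z) :
    (mfderiv 𝓘(ℝ, Coord n) (𝓡 n) φ z : Coord n →L[ℝ] Coord n) =
      (mfderiv 𝓘(ℝ, Coord n) (𝓡 n) φ' (ψ z) : Coord n →L[ℝ] Coord n) ∘L fderiv ℝ ψ z := by
  have h3 := mfderiv_comp (I := 𝓘(ℝ, Coord n)) (I' := 𝓘(ℝ, Coord n)) (I'' := 𝓡 n) z hφ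
    hψ.mdifferentiableAt
  rw [mfderiv_eq_fderiv] at h3
  exact (h.mfderiv_eq).trans h3

theorem fderiv_eq_mfderiv_comp {M : Type*} [TopologicalSpace M] [ChartedSpace (Coord n) M]
    {φ : Coord n → M} {f : M → Coord n} {z : Coord n}
    (hf : MDifferentiableAt (𝓡 n) 𝓘(ℝ, Coord n) f (φ z))
    (hφ : MDifferentiableAt 𝓘(ℝ, Coord n) (𝓡 n) φ z) :
    fderiv ℝ (fun t => f (φ t)) z =
      (mfderiv (𝓡 n) 𝓘(ℝ, Coord n) f (φ z) : Coord n →L[ℝ] Coord n) ∘L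
        (mfderiv 𝓘(ℝ, Coord n) (𝓡 n) φ z : Coord n →L[ℝ] Coord n) := by
  rw [← mfderiv_eq_fderiv]
  exact mfderiv_comp z hf hφ

/-- Regularity of a section of the tangent bundle can be read off in one chart, because the bundle
trivialization is the derivative of that chart. -/
theorem contMDiffAt_section_of_mfderiv {M : Type*} [TopologicalSpace M] [ChartedSpace (Coord n) M]
    [IsManifold (𝓡 n) 1 M] {φ : Coord n → M} {a : Coord n → Coord n} {z : Coord n}
    {m : WithTop ℕ∞} (hφ : ContMDiffAt 𝓘(ℝ, Coord n) (𝓡 n) m φ z)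
    (ha : ContDiffAt ℝ m (fun t => (mfderiv (𝓡 n) 𝓘(ℝ, Coord n) (extChartAt (𝓡 n) (φ z)) (φ t) :
      Coord n →L[ℝ] Coord n) (a t)) z) :
    ContMDiffAt 𝓘(ℝ, Coord n) ((𝓡 n).prod 𝓘(ℝ, Coord n)) m
      (fun t => TotalSpace.mk' (Coord n) (E := fun x : M => TangentSpace (𝓡 n) x) (φ t) (a t))
      z := by
  rw [contMDiffAt_totalSpace]
  refine ⟨hφ, (contMDiffAt_iff_contDiffAt.2 ha).congr_of_eventuallyEq ?_⟩
  filter_upwards [hφ.continuousAt.eventually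
    ((isOpen_extChartAt_source (I := 𝓡 n) (φ z)).mem_nhds (mem_extChartAt_source (φ z)))] with t ht
  rw [extChartAt_source] at ht
  have h3 := TangentBundle.continuousLinearMapAt_trivializationAt (I := 𝓡 n) ht
  have h4 := Trivialization.coe_linearMapAt_of_mem (R := ℝ)
    (trivializationAt (Coord n) (TangentSpace (𝓡 n)) (φ z)) ht
  rw [← h3]
  exact (congrFun h4 (a t)).symm

theorem contMDiffAt_metric_apply {EB HB B F EM HM M : Type*} [NormedAddCommGroup EB]
    [NormedSpace ℝ EB] [TopologicalSpace HB] {IB : ModelWithCorners ℝ EB HB} {m : WithTop ℕ∞}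
    [TopologicalSpace B] [ChartedSpace HB B] [NormedAddCommGroup F] [NormedSpace ℝ F]
    {E : B → Type*} [TopologicalSpace (TotalSpace F E)] [∀ x, AddCommGroup (E x)]
    [∀ x, Module ℝ (E x)] [∀ x, TopologicalSpace (E x)] [∀ x, IsTopologicalAddGroup (E x)]
    [∀ x, ContinuousSMul ℝ (E x)] [FiberBundle F E] [VectorBundle ℝ F E] [NormedAddCommGroup EM]
    [NormedSpace ℝ EM] [TopologicalSpace HM] {IM : ModelWithCorners ℝ EM HM} [TopologicalSpace M]
    [ChartedSpace HM M] (g : ContMDiffRiemannianMetric IB m F E) {b : M → B} {v w : ∀ x, E (b x)}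
    {x : M} (hb : ContMDiffAt IM IB m b x)
    (hv : ContMDiffAt IM (IB.prod 𝓘(ℝ, F)) m (fun t => TotalSpace.mk' F (b t) (v t)) x)
    (hw : ContMDiffAt IM (IB.prod 𝓘(ℝ, F)) m (fun t => TotalSpace.mk' F (b t) (w t)) x) :
    ContMDiffAt IM 𝓘(ℝ) m (fun t => g.inner (b t) (v t) (w t)) x := by
  have : ContMDiffAt IM (IB.prod 𝓘(ℝ)) m
      (fun t ↦ TotalSpace.mk' ℝ (E := Bundle.Trivial B ℝ) (b t) (g.inner (b t) (v t) (w t))) x := by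
    apply ContMDiffAt.clm_bundle_apply₂ (F₁ := F) (F₂ := F)
    · exact g.contMDiff.contMDiffAt.comp x hb
    · exact hv
    · exact hw
  simp only [contMDiffAt_totalSpace] at this
  exact this.2

/-- The derivative of the inverse of the chart around `p₀`. -/
def frame (p₀ : Sph n) (z : Coord n) : Coord n →L[ℝ] Coord n :=
  mfderiv 𝓘(ℝ, Coord n) (𝓡 n) (extChartAt (𝓡 n) p₀).symm z

/-- The transition map from the chart around `p₀` to the chart around `q`. -/
def transition (p₀ q : Sph n) (z : Coord n) : Coord n :=
  extChartAt (𝓡 n) q ((extChartAt (𝓡 n) p₀).symm z)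

theorem inChart_apply (T : TensorField n) (p₀ : Sph n) (z u v : Coord n) :
    inChart T p₀ z u v = T ((extChartAt (𝓡 n) p₀).symm z) (frame p₀ z u) (frame p₀ z v) := rfl

theorem isOpen_target (p₀ : Sph n) : IsOpen (extChartAt (𝓡 n) p₀).target :=
  isOpen_extChartAt_target p₀

variable {p₀ q : Sph n} {z : Coord n}

theorem contMDiffAt_chart_symm (hz : z ∈ (extChartAt (𝓡 n) p₀).target) (m : WithTop ℕ∞) :
    ContMDiffAt 𝓘(ℝ, Coord n) (𝓡 n) m (extChartAt (𝓡 n) p₀).symm z :=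
  ((contMDiffOn_extChartAt_symm (n := ω) p₀).contMDiffAt ((isOpen_target p₀).mem_nhds hz)).of_le
    le_top

theorem contMDiffAt_chart {x : Sph n} (hx : x ∈ (extChartAt (𝓡 n) q).source) (m : WithTop ℕ∞) :
    ContMDiffAt (𝓡 n) 𝓘(ℝ, Coord n) m (extChartAt (𝓡 n) q) x :=
  (contMDiffAt_extChartAt' (n := ω) (by rwa [extChartAt_source] at hx)).of_le le_top

theorem isInvertible_frame (hz : z ∈ (extChartAt (𝓡 n) p₀).target) :
    (frame p₀ z).IsInvertible := by
  have h := isInvertible_mfderivWithin_extChartAt_symm (I := 𝓡 n) hz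
  simp only [modelWithCornersSelf_coe, Set.range_id, mfderivWithin_univ] at h
  exact h

theorem contDiffAt_transition (hz : z ∈ (extChartAt (𝓡 n) p₀).target)
    (hq : (extChartAt (𝓡 n) p₀).symm z ∈ (extChartAt (𝓡 n) q).source) (m : WithTop ℕ∞) :
    ContDiffAt ℝ m (transition p₀ q) z :=
  contMDiffAt_iff_contDiffAt.1
    ((contMDiffAt_chart hq m).comp z (contMDiffAt_chart_symm hz m))

theorem fderiv_transition (hz : z ∈ (extChartAt (𝓡 n) p₀).target)
    (hq : (extChartAt (𝓡 n) p₀).symm z ∈ (extChartAt (𝓡 n) q).source) :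
    fderiv ℝ (transition p₀ q) z =
      (mfderiv (𝓡 n) 𝓘(ℝ, Coord n) (extChartAt (𝓡 n) q) ((extChartAt (𝓡 n) p₀).symm z) :
        Coord n →L[ℝ] Coord n) ∘L frame p₀ z := by
  exact fderiv_eq_mfderiv_comp ((contMDiffAt_chart hq 1).mdifferentiableAt one_ne_zero)
    ((contMDiffAt_chart_symm hz 1).mdifferentiableAt one_ne_zero)

theorem eventually_mem_target (hz : z ∈ (extChartAt (𝓡 n) p₀).target) :
    ∀ᶠ t in 𝓝 z, t ∈ (extChartAt (𝓡 n) p₀).target :=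
  (isOpen_target p₀).mem_nhds hz

theorem eventually_mem_source (hz : z ∈ (extChartAt (𝓡 n) p₀).target)
    (hq : (extChartAt (𝓡 n) p₀).symm z ∈ (extChartAt (𝓡 n) q).source) :
    ∀ᶠ t in 𝓝 z, (extChartAt (𝓡 n) p₀).symm t ∈ (extChartAt (𝓡 n) q).source :=
  (contMDiffAt_chart_symm hz 1).continuousAt.eventually
    ((isOpen_extChartAt_source q).mem_nhds hq)

theorem frame_eq_comp_transition (hz : z ∈ (extChartAt (𝓡 n) p₀).target)
    (hq : (extChartAt (𝓡 n) p₀).symm z ∈ (extChartAt (𝓡 n) q).source) :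
    frame p₀ z = frame q (transition p₀ q z) ∘L fderiv ℝ (transition p₀ q) z := by
  have h1 : (extChartAt (𝓡 n) p₀).symm =ᶠ[𝓝 z]
      (extChartAt (𝓡 n) q).symm ∘ transition p₀ q := by
    filter_upwards [eventually_mem_source hz hq] with t ht
    exact ((extChartAt (𝓡 n) q).left_inv ht).symm
  have h2 : transition p₀ q z ∈ (extChartAt (𝓡 n) q).target := (extChartAt (𝓡 n) q).map_source hq
  exact mfderiv_eq_comp_fderiv h1
    ((contMDiffAt_chart_symm h2 1).mdifferentiableAt one_ne_zero)
    ((contDiffAt_transition hz hq 1).differentiableAt one_ne_zero)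

theorem inChart_eq_transition (T : TensorField n) (hz : z ∈ (extChartAt (𝓡 n) p₀).target)
    (hq : (extChartAt (𝓡 n) p₀).symm z ∈ (extChartAt (𝓡 n) q).source) (u v : Coord n) :
    inChart T p₀ z u v = inChart T q (transition p₀ q z) (fderiv ℝ (transition p₀ q) z u)
      (fderiv ℝ (transition p₀ q) z v) := by
  -- The base points agree only propositionally, so the fibres are all viewed as `Coord n` before
  -- the equality is substituted.
  have key : ∀ (x x' : Sph n) (a b : Coord n), x = x' →
      (T x : Coord n →L[ℝ] Coord n →L[ℝ] ℝ) a b =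
        (T x' : Coord n →L[ℝ] Coord n →L[ℝ] ℝ) a b := by
    rintro x x' a b rfl
    rfl
  rw [inChart_apply, inChart_apply, frame_eq_comp_transition hz hq]
  exact key _ _ _ _ ((extChartAt (𝓡 n) q).left_inv hq).symm

theorem contMDiffAt_frame_section (hz : z ∈ (extChartAt (𝓡 n) p₀).target) (u : Coord n) :
    ContMDiffAt 𝓘(ℝ, Coord n) ((𝓡 n).prod 𝓘(ℝ, Coord n)) 2
      (fun t => TotalSpace.mk' (Coord n) (E := fun x : Sph n => TangentSpace (𝓡 n) x)
        ((extChartAt (𝓡 n) p₀).symm t) (frame p₀ t u)) z := by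
  refine contMDiffAt_section_of_mfderiv (contMDiffAt_chart_symm hz 2) ?_
  have hq : (extChartAt (𝓡 n) p₀).symm z ∈
      (extChartAt (𝓡 n) ((extChartAt (𝓡 n) p₀).symm z)).source := mem_extChartAt_source _
  have h1 : ContDiffAt ℝ 2
      (fun t => fderiv ℝ (transition p₀ ((extChartAt (𝓡 n) p₀).symm z)) t u) z :=
    ((contDiffAt_transition hz hq 3).fderiv_right (by norm_num)).clm_apply contDiffAt_const
  refine h1.congr_of_eventuallyEq ?_
  filter_upwards [eventually_mem_target hz, eventually_mem_source hz hq] with t ht htq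
  rw [fderiv_transition ht htq]
  rfl

/-- Passes from C² as a section of a bundle to C² of the components, by evaluating g on the
coordinate frame. -/
theorem contDiffOn_inChart (g : C2Metric n) (p₀ : Sph n) :
    ContDiffOn ℝ 2 (inChart g.inner p₀) (extChartAt (𝓡 n) p₀).target := by
  rw [contDiffOn_clm_apply]
  intro u
  rw [contDiffOn_clm_apply]
  intro v z hz
  refine ContDiffAt.contDiffWithinAt ?_
  exact contMDiffAt_iff_contDiffAt.1 <| contMDiffAt_metric_apply g (contMDiffAt_chart_symm hz 2)
    (contMDiffAt_frame_section hz u) (contMDiffAt_frame_section hz v)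

end Charts

/-! ### Smooth dependence of the solution on the data -/

/-- The implicit function theorem for Φ(a, x) − b = 0 with parameter (a, b). Derivatives along lines
suffice to identify the partial derivative in x, and in finite dimension its injectivity gives
invertibility. -/
theorem exists_implicit_solution {V : Type*} [NormedAddCommGroup V] [NormedSpace ℝ V]
    [FiniteDimensional ℝ V] {Φ : V × V → V} {L : V → V} {a x : V} {m : WithTop ℕ∞}
    (hΦ : ContDiffAt ℝ m Φ (a, x)) (hm : m ≠ 0)
    (hline : ∀ w, HasDerivAt (fun t : ℝ => Φ (a, x + t • w)) (L w) 0)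
    (hL : ∀ w, L w = 0 → w = 0) :
    ∃ Θ : V × V → V, ContDiffAt ℝ m Θ (a, Φ (a, x)) ∧ Θ (a, Φ (a, x)) = x ∧
      ∀ᶠ p in 𝓝 (a, Φ (a, x)), Φ (p.1, Θ p) = p.2 := by
  have := FiniteDimensional.complete ℝ V
  let f : (V × V) × V → V := fun p => Φ (p.1.1, p.2) - p.1.2
  let x₀ : (V × V) × V := ((a, Φ (a, x)), x)
  have hf : ContDiffAt ℝ m f x₀ := by
    have h1 : ContDiffAt ℝ m (fun p : (V × V) × V => (p.1.1, p.2)) x₀ :=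
      contDiffAt_fst.fst.prodMk contDiffAt_snd
    exact (ContDiffAt.comp x₀ (g := Φ) hΦ h1).sub contDiffAt_fst.snd
  have hlin : ∀ w, fderiv ℝ f x₀ (0, w) = L w := fun w => by
    have h1 := (hf.differentiableAt hm).hasFDerivAt.hasLineDerivAt (0, w)
    have h2 : HasDerivAt (fun t : ℝ => f (x₀ + t • (0, w))) (L w) 0 := by
      refine ((hline w).sub_const (Φ (a, x))).congr_of_eventuallyEq
        (Eventually.of_forall fun t => ?_)
      simp [f, x₀]
    exact h1.unique h2
  have hinj : Function.Injective ((fderiv ℝ f x₀ ∘L .inr ℝ (V × V) V : V →L[ℝ] V) : V →ₗ[ℝ] V) := by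
    rw [← LinearMap.ker_eq_bot, LinearMap.ker_eq_bot']
    intro w hw
    refine hL w ?_
    rw [← hlin]
    exact hw
  have hinv : (fderiv ℝ f x₀ ∘L .inr ℝ (V × V) V).IsInvertible := by
    refine ⟨(LinearEquiv.ofInjectiveEndo _ hinj).toContinuousLinearEquiv, ?_⟩
    ext w : 1
    rfl
  refine ⟨hf.implicitFunction hm hinv, hf.contDiffAt_implicitFunction hm hinv,
    hf.implicitFunction_apply_self hm hinv, ?_⟩
  filter_upwards [hf.eventually_apply_implicitFunction hm hinv] with p hp
  have h0 : f x₀ = 0 := sub_self _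
  rw [h0] at hp
  exact sub_eq_zero.1 hp

/-- The contracted Gauss equation is natural under linear isomorphisms. -/
theorem gaussMap_bilinearComp {E : Type*} [NormedAddCommGroup E] [NormedSpace ℝ E]
    [FiniteDimensional ℝ E] {G : E →L[ℝ] E →L[ℝ] ℝ} (hG : IsInner G) (X : E →L[ℝ] E →L[ℝ] ℝ)
    {A : E →L[ℝ] E} (hA : A.IsInvertible) (hG' : IsInner (G.bilinearComp A A)) (u v : E) :
    gaussMap (G.bilinearComp A A) (X.bilinearComp A A) u v = gaussMap G X (A u) (A v) := by
  have h1 : (G.bilinearComp A A).inverse ∘L X.bilinearComp A A =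
      A.inverse ∘L ((G.inverse ∘L X) ∘L A) := by
    ext w : 1
    refine hG'.isInvertible.inverse_apply_eq.2 ?_
    ext z
    change X (A w) (A z) = G (A (A.inverse (G.inverse (X (A w))))) (A z)
    rw [hA.self_apply_inverse, hG.isInvertible.self_apply_inverse]
  have h2 : LinearMap.trace ℝ E (A.inverse ∘L ((G.inverse ∘L X) ∘L A) : E →L[ℝ] E) =
      LinearMap.trace ℝ E (G.inverse ∘L X : E →L[ℝ] E) := by
    have h3 := LinearMap.trace_comp_comm' (R := ℝ)
      (((G.inverse ∘L X) ∘L A : E →L[ℝ] E) : E →ₗ[ℝ] E) (A.inverse : E →ₗ[ℝ] E)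
    refine h3.trans (congrArg _ ?_)
    ext w
    change G.inverse (X (A (A.inverse w))) = G.inverse (X w)
    rw [hA.self_apply_inverse]
  unfold gaussMap
  rw [h1, h2]
  change _ * X (A u) (A v) - X (A (A.inverse (G.inverse (X (A u))))) (A v) = _
  rw [hA.self_apply_inverse]
  rfl

/-! ### The local solution map and the regularity of solutions -/

section Implicit

variable {n : ℕ} {G X Y : Coord n →L[ℝ] Coord n →L[ℝ] ℝ}

/-- The trace of an endomorphism of `ℝⁿ`, as a continuous linear map. -/
def traceCLM : (Coord n →L[ℝ] Coord n) →L[ℝ] ℝ :=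
  LinearMap.toContinuousLinearMap
    (LinearMap.trace ℝ (Coord n) ∘ₗ ContinuousLinearMap.coeLM ℝ)

theorem gaussMap_eq_traceCLM (G X : Coord n →L[ℝ] Coord n →L[ℝ] ℝ) :
    gaussMap G X = traceCLM (G.inverse ∘L X) • X - X ∘L G.inverse ∘L X := rfl

theorem contDiffAt_gaussMap (hG : IsInner G) (m : WithTop ℕ∞) :
    ContDiffAt ℝ m (fun p : (Coord n →L[ℝ] Coord n →L[ℝ] ℝ) × (Coord n →L[ℝ] Coord n →L[ℝ] ℝ) =>
      gaussMap p.1 p.2) (G, X) := by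
  simp only [gaussMap_eq_traceCLM]
  have h1 : ContDiffAt ℝ m (fun p : (Coord n →L[ℝ] Coord n →L[ℝ] ℝ) ×
      (Coord n →L[ℝ] Coord n →L[ℝ] ℝ) => p.1.inverse ∘L p.2) (G, X) :=
    ((contDiffAt_inverse hG.isInvertible m).comp (G, X) contDiffAt_fst).clm_comp contDiffAt_snd
  exact ((traceCLM.contDiff.contDiffAt.comp (G, X) h1).smul contDiffAt_snd).sub
    (contDiffAt_snd.clm_comp h1)

theorem gaussMap_add_smul (G X Y : Coord n →L[ℝ] Coord n →L[ℝ] ℝ) (t : ℝ) :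
    gaussMap G (X + t • Y) = gaussMap G X + t • gaussLin G X Y + t ^ 2 • gaussMap G Y := by
  ext u v
  simp only [gaussLin, gaussMap, ContinuousLinearMap.comp_add, ContinuousLinearMap.comp_smul,
    ContinuousLinearMap.toLinearMap_add, ContinuousLinearMap.toLinearMap_smul, map_add, map_smul,
    ContinuousLinearMap.add_comp, ContinuousLinearMap.smul_comp, sub_apply, add_apply, smul_apply,
    smul_eq_mul]
  ring

theorem hasDerivAt_gaussMap_line (G X Y : Coord n →L[ℝ] Coord n →L[ℝ] ℝ) :
    HasDerivAt (fun t : ℝ => gaussMap G (X + t • Y)) (gaussLin G X Y) 0 := by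
  simp only [gaussMap_add_smul]
  have h1 : HasDerivAt (fun t : ℝ => t • gaussLin G X Y) ((1 : ℝ) • gaussLin G X Y) 0 :=
    (hasDerivAt_id (0 : ℝ)).smul_const _
  have h2 : HasDerivAt (fun t : ℝ => t ^ 2 • gaussMap G Y) ((2 * (0 : ℝ)) • gaussMap G Y) 0 := by
    simpa using (hasDerivAt_pow 2 (0 : ℝ)).smul_const (gaussMap G Y)
  have h3 := (h1.const_add (gaussMap G X)).add h2
  have h4 : (1 : ℝ) • gaussLin G X Y + (2 * (0 : ℝ)) • gaussMap G Y = gaussLin G X Y := by simp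
  rw [h4] at h3
  exact h3

/-- The contracted Gauss equation has a smooth local solution map. -/
theorem exists_local_solution (hn : 3 ≤ n) (hG : IsInner G) (hX : IsInner X) {m : WithTop ℕ∞}
    (hm : m ≠ 0) :
    ∃ Θ : (Coord n →L[ℝ] Coord n →L[ℝ] ℝ) × (Coord n →L[ℝ] Coord n →L[ℝ] ℝ) →
        Coord n →L[ℝ] Coord n →L[ℝ] ℝ,
      ContDiffAt ℝ m Θ (G, gaussMap G X) ∧ Θ (G, gaussMap G X) = X ∧
      ∀ᶠ p in 𝓝 (G, gaussMap G X), gaussMap p.1 (Θ p) = p.2 := by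
  exact exists_implicit_solution (contDiffAt_gaussMap hG m) hm
    (hasDerivAt_gaussMap_line G X) fun Y hY =>
      eq_zero_of_gaussLin_eq_zero (finrank_euclideanSpace_fin (𝕜 := ℝ) (n := n)) hn hG hX hY

theorem IsInner.add (hX : IsInner X) (hY : IsInner Y) : IsInner (X + Y) :=
  ⟨fun u v => by simp only [add_apply, hX.symm u v, hY.symm u v],
    fun u hu => add_pos (hX.pos u hu) (hY.pos u hu)⟩

/-- Positivity on the compact unit sphere is an open condition on the form; homogeneity gives the
other vectors. -/
theorem IsInner.eventually_pos (hX : IsInner X) :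
    ∀ᶠ B in 𝓝 X, ∀ u : Coord n, u ≠ 0 → 0 < B u u := by
  have h1 : ∀ᶠ B in 𝓝 X, ∀ u ∈ sphere (0 : Coord n) 1, 0 < B u u := by
    refine (isCompact_sphere (0 : Coord n) 1).eventually_forall_of_forall_eventually fun u hu => ?_
    have hc : Continuous fun p : (Coord n →L[ℝ] Coord n →L[ℝ] ℝ) × Coord n => p.1 p.2 p.2 := by
      fun_prop
    exact hc.continuousAt.eventually_const_lt (hX.pos u (ne_of_mem_sphere hu one_ne_zero))
  filter_upwards [h1] with B hB u hu
  have h2 := hB (‖u‖⁻¹ • u) (by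
    rw [mem_sphere_zero_iff_norm, norm_smul, norm_inv, norm_norm,
      inv_mul_cancel₀ (norm_ne_zero_iff.2 hu)])
  simp only [map_smul, smul_apply, smul_eq_mul, ← mul_assoc] at h2
  exact pos_of_mul_pos_right h2 (mul_self_nonneg _)

/-- The implicit function takes values in all bilinear forms; this equivariance under transposition
is used to recover their symmetry. -/
theorem gaussMap_flip (hG : IsInner G) (X : Coord n →L[ℝ] Coord n →L[ℝ] ℝ) (u v : Coord n) :
    gaussMap G X.flip u v = gaussMap G X v u := by
  obtain ⟨b, -, hb, -⟩ := hG.exists_basis (finrank_euclideanSpace_fin (𝕜 := ℝ) (n := n)) 0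
    (fun _ _ => rfl)
  have h1 : X v (G.inverse (X.flip u)) = X (G.inverse (X v)) u := by
    have hu := hG.isInvertible.self_apply_inverse (X.flip u)
    have hv := hG.isInvertible.self_apply_inverse (X v)
    calc X v (G.inverse (X.flip u)) = G (G.inverse (X v)) (G.inverse (X.flip u)) := by rw [hv]
      _ = X.flip u (G.inverse (X v)) := by rw [hG.symm, hu]
  simp only [gaussMap, trace_inverse_comp hG hb, sub_apply, smul_apply, smul_eq_mul,
    ContinuousLinearMap.comp_apply, ContinuousLinearMap.flip_apply, h1]

/-- Hölder regularity of a field of solutions of the contracted Gauss equation. -/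
theorem holderAt_of_gaussMap_eq {k : ℕ} {α : ℝ≥0} (hα : α ≤ 1) (hn : 3 ≤ n)
    {G R X : Coord n → Coord n →L[ℝ] Coord n →L[ℝ] ℝ} {y : Coord n} (hG : HolderAt k α G y)
    (hR : HolderAt k α R y)
    (h : ∀ᶠ z in 𝓝 y, IsInner (G z) ∧ IsInner (X z) ∧ gaussMap (G z) (X z) = R z) :
    HolderAt k α X y := by
  have hdim := finrank_euclideanSpace_fin (𝕜 := ℝ) (n := n)
  obtain ⟨hGy, hXy, hy⟩ := h.self_of_nhds
  obtain ⟨Θ, hΘ, hΘy, hev⟩ := exists_local_solution hn hGy hXy (m := (k + 1 : ℕ))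
    (by exact_mod_cast k.succ_ne_zero)
  rw [hy] at hΘ hΘy hev
  have hW : HolderAt k α (fun z => Θ (G z, R z)) y :=
    (hG.prodMk hR).contDiffAt_comp (Φ := Θ) hα hΘ
  refine hW.congr ?_
  have hGR : ContinuousAt (fun z => (G z, R z)) y :=
    hG.1.continuousAt.prodMk hR.1.continuousAt
  have hpos := hXy.eventually_pos
  rw [← hΘy] at hpos
  filter_upwards [h, hGR.eventually hev, hW.1.continuousAt.eventually hpos]
    with z ⟨h1, h2, h3⟩ h4 h5
  -- The right-hand side R is symmetric because X is, so the transpose of Θ solves the same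
  -- equation. The sum of Θ and its transpose is symmetric and, near y, positive definite, which
  -- forces Θ to equal its transpose.
  have hflip : gaussMap (G z) (Θ (G z, R z)).flip = gaussMap (G z) (Θ (G z, R z)) := by
    have hXflip : (X z).flip = X z := by
      ext u v
      exact h2.symm v u
    ext u v
    rw [gaussMap_flip h1, h4, ← h3, ← gaussMap_flip h1, hXflip]
  have hsymm : (Θ (G z, R z)).flip = Θ (G z, R z) := by
    refine gaussMap_injective_of_add hdim hn h1 ⟨fun u v => ?_, fun u hu => ?_⟩ hflip
    · simp only [add_apply, ContinuousLinearMap.flip_apply, add_comm]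
    · exact add_pos (h5 u hu) (h5 u hu)
  have hinner : IsInner (Θ (G z, R z)) := ⟨fun u v => by
    conv_lhs => rw [← hsymm]
    rfl, h5⟩
  -- Pointwise uniqueness identifies X with Θ(G, R) near y, although X is not assumed continuous.
  exact gaussMap_injective_of_add hdim hn h1 (h2.add hinner) (h3.trans h4.symm)

end Implicit

/-! ### The contracted Gauss equation on the sphere -/

section Sphere

variable {n : ℕ}

/-- The value at `p` of a tensor field, in the coordinates of the preferred chart. -/
def formAt (T : TensorField n) (p : Sph n) : Coord n →L[ℝ] Coord n →L[ℝ] ℝ := T p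

theorem formAt_inChart_self (T : TensorField n) (p : Sph n) :
    inChart T p (extChartAt (𝓡 n) p p) = formAt T p := by
  ext u v
  exact inChart_self T p u v

theorem inChart_eq_bilinearComp (T : TensorField n) (p₀ : Sph n) (z : Coord n) :
    inChart T p₀ z = (formAt T ((extChartAt (𝓡 n) p₀).symm z)).bilinearComp (frame p₀ z)
      (frame p₀ z) := rfl

theorem isInner_metric (g : C2Metric n) (p : Sph n) : IsInner (formAt g.inner p) :=
  ⟨g.symm p, g.pos p⟩

theorem IsInner.inChart {T : TensorField n} {p₀ : Sph n} {z : Coord n}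
    (hz : z ∈ (extChartAt (𝓡 n) p₀).target)
    (hT : IsInner (formAt T ((extChartAt (𝓡 n) p₀).symm z))) : IsInner (inChart T p₀ z) := by
  rw [inChart_eq_bilinearComp]
  refine ⟨fun u v => hT.symm _ _, fun u hu => hT.pos _ fun h0 => hu ?_⟩
  exact (isInvertible_frame hz).injective (h0.trans (map_zero _).symm)

theorem isMetricAt_inChart (g : C2Metric n) {p₀ : Sph n} {z : Coord n}
    (hz : z ∈ (extChartAt (𝓡 n) p₀).target) : IsMetricAt (inChart g.inner p₀) z := by
  refine ⟨(contDiffOn_inChart g p₀).contDiffAt ((isOpen_target p₀).mem_nhds hz), ?_⟩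
  filter_upwards [eventually_mem_target hz] with t ht
  exact (isInner_metric g _).inChart ht

theorem isMetricAt_self (g : C2Metric n) (p : Sph n) :
    IsMetricAt (inChart g.inner p) (extChartAt (𝓡 n) p p) :=
  isMetricAt_inChart g (mem_extChartAt_target p)

theorem frame_self (p : Sph n) : frame p (extChartAt (𝓡 n) p p) = ContinuousLinearMap.id ℝ _ := by
  have h := mfderivWithin_range_extChartAt_symm (I := 𝓡 n) (x := p)
  simp only [modelWithCornersSelf_coe, Set.range_id, mfderivWithin_univ] at h
  exact h

/-- The Ricci curvature computed in an arbitrary chart. -/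
theorem ricciLocal_inChart (g : C2Metric n) {p₀ : Sph n} {z : Coord n}
    (hz : z ∈ (extChartAt (𝓡 n) p₀).target) {q : Sph n} (hq : (extChartAt (𝓡 n) p₀).symm z = q)
    (u v : Coord n) :
    ricciLocal (inChart g.inner p₀) z u v =
      ricciLocal (inChart g.inner q) (extChartAt (𝓡 n) q q) (frame p₀ z u) (frame p₀ z v) := by
  have hs : (extChartAt (𝓡 n) p₀).symm z ∈ (extChartAt (𝓡 n) q).source := by
    rw [hq]
    exact mem_extChartAt_source q
  have hψ : transition p₀ q z = extChartAt (𝓡 n) q q := congrArg (extChartAt (𝓡 n) q) hq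
  have hpb : IsPullbackAt (transition p₀ q) (inChart g.inner p₀) (inChart g.inner q) z := by
    refine ⟨contDiffAt_transition hz hs 3, isMetricAt_inChart g hz, ?_, ?_⟩
    · rw [hψ]
      exact isMetricAt_self g q
    · filter_upwards [eventually_mem_target hz, eventually_mem_source hz hs] with t ht hts u v
      exact inChart_eq_transition g.inner ht hts u v
  have hfr : frame p₀ z = fderiv ℝ (transition p₀ q) z := by
    rw [frame_eq_comp_transition hz hs, hψ, frame_self, ContinuousLinearMap.id_comp]
  rw [hpb.ricciLocal, hψ, hfr]

theorem onceContractedGauss_iff (g : C2Metric n) (χ : TensorField n) :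
    OnceContractedGauss g χ ↔ ∀ (p : Sph n) (u v : Coord n),
      ricciLocal (inChart g.inner p) (extChartAt (𝓡 n) p p) u v =
        gaussMap (formAt g.inner p) (formAt χ p) u v := Iff.rfl

theorem isSolution_iff (g : C2Metric n) (χ : TensorField n) :
    IsSolution g χ ↔ ∀ p : Sph n, IsInner (formAt χ p) ∧ ∀ u v : Coord n,
      ricciLocal (inChart g.inner p) (extChartAt (𝓡 n) p p) u v =
        gaussMap (formAt g.inner p) (formAt χ p) u v := by
  constructor
  · rintro ⟨h1, h2, h3⟩ p
    exact ⟨⟨h1 p, h2 p⟩, (onceContractedGauss_iff g χ).1 h3 p⟩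
  · intro h
    exact ⟨fun p => (h p).1.symm, fun p => (h p).1.pos,
      (onceContractedGauss_iff g χ).2 fun p => (h p).2⟩

theorem IsInner.sq_le {G : Coord n →L[ℝ] Coord n →L[ℝ] ℝ} (hG : IsInner G) (u v : Coord n) :
    0 ≤ G u u * G v v - G u v ^ 2 := by
  by_cases hv : v = 0
  · simp [hv]
  have hvv := hG.pos v hv
  have h1 : 0 ≤ G (G v v • u - G u v • v) (G v v • u - G u v • v) := by
    by_cases h0 : G v v • u - G u v • v = 0
    · simp [h0]
    · exact (hG.pos _ h0).le
  simp only [map_sub, map_smul, sub_apply, smul_apply, smul_eq_mul, hG.symm v u] at h1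
  have h2 : 0 ≤ G v v * (G u u * G v v - G u v ^ 2) := by linarith
  exact nonneg_of_mul_nonneg_right h2 hvv

theorem riemann_pos_of_sectionalCurvature_pos {g : C2Metric n}
    (hg : HasPositiveSectionalCurvature g) (p : Sph n) (u v : Coord n)
    (huv : LinearIndependent ℝ ![u, v]) :
    0 < formAt g.inner p
      (riemann (inChart g.inner p) (extChartAt (𝓡 n) p p) u v v) u := by
  have h1 : 0 < formAt g.inner p
      (riemann (inChart g.inner p) (extChartAt (𝓡 n) p p) u v v) u /
      (formAt g.inner p u u * formAt g.inner p v v - formAt g.inner p u v ^ 2) := hg p u v huv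
  have h2 := (isInner_metric g p).sq_le u v
  -- A nonnegative denominator is enough: a nonpositive numerator would make the quotient
  -- nonpositive, also when the denominator is zero.
  by_contra! h3
  exact absurd h1 (not_lt.2 (div_nonpos_of_nonpos_of_nonneg h3 h2))

theorem exists_solution (hn : 3 ≤ n) {g : C2Metric n} (hg : HasPositiveSectionalCurvature g) :
    ∃ χ : TensorField n, IsSolution g χ := by
  have h : ∀ p : Sph n, ∃ X : Coord n →L[ℝ] Coord n →L[ℝ] ℝ, IsInner X ∧ ∀ u v : Coord n,
      ricciLocal (inChart g.inner p) (extChartAt (𝓡 n) p p) u v =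
        gaussMap (formAt g.inner p) X u v := fun p => by
    have h1 := (isMetricAt_self g p).exists_isInner_gaussMap_eq hn
    rw [formAt_inChart_self] at h1
    exact h1 (riemann_pos_of_sectionalCurvature_pos hg p)
  choose X hX using h
  exact ⟨X, (isSolution_iff g X).2 hX⟩

theorem solution_unique (hn : 3 ≤ n) {g : C2Metric n} {χ χ' : TensorField n}
    (h : IsSolution g χ) (h' : IsSolution g χ') : χ = χ' := by
  rw [isSolution_iff] at h h'
  funext p
  have key : formAt χ p = formAt χ' p := by
    refine gaussMap_injective_of_add (finrank_euclideanSpace_fin (𝕜 := ℝ) (n := n)) hn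
      (isInner_metric g p) ((h p).1.add (h' p).1) ?_
    ext u v
    rw [← (h p).2, ← (h' p).2]
  exact key

/-- Both sides transform as tensors, so the equation, posed at each point in its own chart, holds
throughout a fixed chart. -/
theorem gaussMap_inChart {g : C2Metric n} {χ : TensorField n} (h : IsSolution g χ) {p₀ : Sph n}
    {z : Coord n} (hz : z ∈ (extChartAt (𝓡 n) p₀).target) (u v : Coord n) :
    gaussMap (inChart g.inner p₀ z) (inChart χ p₀ z) u v =
      ricciLocal (inChart g.inner p₀) z u v := by
  rw [isSolution_iff] at h
  rw [ricciLocal_inChart g hz rfl, (h _).2]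
  exact gaussMap_bilinearComp (isInner_metric g _) _ (isInvertible_frame hz)
    ((isInner_metric g _).inChart hz) u v

theorem isHolderClass_iff (k : ℕ) (α : ℝ≥0) (T : TensorField n) :
    IsHolderClass k α T ↔
      ∀ p₀ : Sph n, ∀ z ∈ (extChartAt (𝓡 n) p₀).target, HolderAt k α (inChart T p₀) z := by
  constructor
  · intro h p₀ z hz
    exact ⟨(h p₀).1.contDiffAt ((isOpen_target p₀).mem_nhds hz), (h p₀).2 z hz⟩
  · intro h p₀
    exact ⟨fun z hz => (h p₀ z hz).1.contDiffWithinAt, fun z hz => (h p₀ z hz).2⟩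

/-- The Ricci curvature in coordinates, as a field of continuous bilinear forms assembled from its
components. -/
def ricciField (G : Coord n → Coord n →L[ℝ] Coord n →L[ℝ] ℝ) (z : Coord n) :
    Coord n →L[ℝ] Coord n →L[ℝ] ℝ :=
  ∑ i : Fin n, ∑ j : Fin n,
    ricciLocal G z (EuclideanSpace.single i 1) (EuclideanSpace.single j 1) •
      (EuclideanSpace.proj i : Coord n →L[ℝ] ℝ).smulRight
        (EuclideanSpace.proj j : Coord n →L[ℝ] ℝ)

theorem ricciField_single (G : Coord n → Coord n →L[ℝ] Coord n →L[ℝ] ℝ) (z : Coord n)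
    (i j : Fin n) :
    ricciField G z (EuclideanSpace.single i 1) (EuclideanSpace.single j 1) =
      ricciLocal G z (EuclideanSpace.single i 1) (EuclideanSpace.single j 1) := by
  simp [ricciField, sum_apply]

theorem HolderAt.ricciField {k : ℕ} {α : ℝ≥0} (hα : α ≤ 1)
    {G : Coord n → Coord n →L[ℝ] Coord n →L[ℝ] ℝ} {y : Coord n} (hG : HolderAt (k + 2) α G y)
    (hi : IsInner (G y)) : HolderAt k α (ricciField G) y :=
  HolderAt.sum hα fun i _ => HolderAt.sum hα fun j _ =>
    (hG.ricciLocal hα hi (EuclideanSpace.single i 1) (EuclideanSpace.single j 1)).clm_comp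
      (ContinuousLinearMap.toSpanSingleton ℝ
        ((EuclideanSpace.proj i : Coord n →L[ℝ] ℝ).smulRight
          (EuclideanSpace.proj j : Coord n →L[ℝ] ℝ)))

/-- In a fixed chart g is of class C^{k+2,α} and Ric of class C^{k,α}; the local solution map
transfers the latter class to χ. -/
theorem solution_isHolderClass (hn : 3 ≤ n) {g : C2Metric n} {χ : TensorField n}
    (h : IsSolution g χ) {k : ℕ} {α : ℝ≥0} (hα : α ≤ 1) (hg : IsHolderClass (k + 2) α g.inner) :
    IsHolderClass k α χ := by
  rw [isHolderClass_iff] at hg ⊢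
  intro p₀ y hy
  have hG := hg p₀ y hy
  refine holderAt_of_gaussMap_eq hα hn ((hG.of_succ hα).of_succ hα)
    (hG.ricciField hα ((isInner_metric g _).inChart hy)) ?_
  filter_upwards [eventually_mem_target hy] with z hz
  refine ⟨(isInner_metric g _).inChart hz, ((isSolution_iff g χ).1 h _).1.inChart hz, ?_⟩
  refine bilin_ext (EuclideanSpace.basisFun (Fin n) ℝ).toBasis fun i j => ?_
  simp only [OrthonormalBasis.coe_toBasis, EuclideanSpace.basisFun_apply]
  rw [gaussMap_inChart h hz, ricciField_single]

end Sphere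

end SphereGauss

end

theorem theorem5p4 (n : ℕ) (hn : 3 ≤ n) (g : SphereGauss.C2Metric n)
    (hg : SphereGauss.HasPositiveSectionalCurvature g) :
    (∃! χ : SphereGauss.TensorField n, SphereGauss.IsSolution g χ) ∧
    ∀ χ : SphereGauss.TensorField n, SphereGauss.IsSolution g χ →
      ∀ (k : ℕ) (α : ℝ≥0), 2 ≤ k → α < 1 →
        SphereGauss.IsHolderClass k α g.inner → SphereGauss.IsHolderClass (k - 2) α χ := by
  refine ⟨?_, fun χ hχ k α hk hα hgk => ?_⟩
  · obtain ⟨χ, hχ⟩ := SphereGauss.exists_solution hn hg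
    exact ⟨χ, hχ, fun χ' hχ' => SphereGauss.solution_unique hn hχ' hχ⟩
  · obtain ⟨m, rfl⟩ := Nat.exists_eq_add_of_le' hk
    exact SphereGauss.solution_isHolderClass hn hχ hα.le hgk
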